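/- Let $\mathbb D=\{z\in\mathbb C:|z-\tfrac23|<1\}$, let $H^\infty(\mathbb D)$ be the Banach space of bounded holomorphic functions on $\mathbb D$ with the uniform norm, let $T(x)=\frac1x-\lfloor\frac1x\rfloor$ for $x\in(0,1]$, $T(0)=0$, and let $\xi(z)=\frac{1}{(\log 2)(1+z)}$. Let $c\colon\{1,2,3,\dots\}\to[0,\infty)$ be bounded, and put $$\mathfrak h(T)=\int_0^1\log|T'(x)|\,\xi(x)\,dx,\qquad \mu=\frac{2}{\mathfrak h(T)}\sum_{n=1}^\infty c(n)\int_{1/(n+1)}^{1/n}\xi(x)\,dx .$$ For $s,\omega\in\mathbb C$ define $$(\mathcal L_{s,\omega}f)(z)=\sum_{n=1}^\infty\frac{e^{\omega c(n)}}{(z+n)^{2s+\mu\omega}}f\Big(\frac1{z+n}\Big),\qquad (\mathcal F_{s,\omega}f)(z)=\sum_{n=2}^\infty\frac{e^{\omega c(n)}}{(z+n)^{2s+\mu\omega}}f\Big(\frac1{z+n}\Big),$$ with the branch of $\log(z+n)$ that is real for $z\in[0,1]$. Then: (i) There is an open set $\mathcal U\subset\{(s,\omega)\in\mathbb C^2:\Re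 s>\frac12\}$ which contains $(s,0)$ for every $s$ with $\Re s>\frac12$, such that for every $(s,\omega)\in\mathcal U$ the two series converge on $\mathbb D$ for all $f\in H^\infty(\mathbb D)$ and define compact linear operators $\mathcal L_{s,\omega}$, $\mathcal F_{s,\omega}$ on $H^\infty(\mathbb D)$. These operators depend holomorphically on $(s,\omega)\in\mathcal U$ (with respect to the operator norm). (ii) For every $f\in L^1([0,1])$ the series defining $(\mathcal L_{1,0}f)(x)$ converges for almost every $x\in[0,1]$; $\mathcal L_{1,0}$ is a bounded operator on $L^1([0,1])$, and $\int_0^1\mathcal L_{1,0}f\,dx=\int_0^1f\,dx$ for all $f\in L^1([0,1])$. If $f,g\colon[0,1]\to\mathbb C$ are such that $f$ and $f\cdot(g\circ T)$ belong to $L^1([0,1])$, then $\mathcal L_{1,0}(f\cdot(g\circ T))=g\cdot\mathcal L_{1,0}f$ almost everywhere on $[0,1]$. There is a constant $C>1$ such that for all $f\in L^1([0,1])$ one has $f\circ T\in L^1([0,1])$ and $\|f\circ T\|_{L^1}\le C\|f\|_{L^1}$. (iii) There is an open set $\mathcal V\subset\mathcal U$ containing $(1,0)$, and there are holomorphic maps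 $(s,\omega)\mapsto\lambda(s,\omega)\in\mathbb C$ and $(s,\omega)\mapsto\mathcal P_{s,\omega},\mathcal N_{s,\omega}$ from $\mathcal V$ to $\mathbb C$ and to the bounded operators on $H^\infty(\mathbb D)$ respectively, such that for all $(s,\omega)\in\mathcal V$: $\mathcal L_{s,\omega}=\lambda(s,\omega)\mathcal P_{s,\omega}+\mathcal N_{s,\omega}$; $\mathcal P_{s,\omega}\mathcal N_{s,\omega}=\mathcal N_{s,\omega}\mathcal P_{s,\omega}=0$; $\mathcal P_{s,\omega}$ is a projection whose range is one-dimensional and is the eigenspace of $\mathcal L_{s,\omega}$ for the eigenvalue $\lambda(s,\omega)$; and the spectral radius satisfies $\rho(\mathcal N_{s,\omega})<1$ and $\rho(\mathcal N_{s,\omega})<|\lambda(s,\omega)|$. Moreover $\lambda(1,0)=1$ and $\mathcal P_{1,0}f=\big(\int_0^1f(x)\,dx\big)\xi$ for all $f\in H^\infty(\mathbb D)$. -/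

import Mathlib

open MeasureTheory Filter Topology
open scoped BoundedContinuousFunction

noncomputable section

namespace GaussEuclid

/-- The Gauss map `T x = 1/x - ⌊1/x⌋` (with `T 0 = 0`). -/
def gaussMap (x : ℝ) : ℝ := 1 / x - (⌊1 / x⌋ : ℝ)

/-- The Gauss density `ξ x = 1 / (log 2 * (1 + x))`. -/
def gaussDensity (x : ℝ) : ℝ := 1 / (Real.log 2 * (1 + x))

/-- The holomorphic extension of the Gauss density. -/
def xi (z : ℂ) : ℂ := 1 / ((Real.log 2 : ℂ) * (1 + z))

/-- The entropy constant `h(T) = ∫₀¹ log |T' x| ξ x dx`. -/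
def entropyConst : ℝ := ∫ x in (0 : ℝ)..1, Real.log |deriv gaussMap x| * gaussDensity x

/-- The mean `μ = (2 / h(T)) ∑_{n ≥ 1} c n ∫_{1/(n+1)}^{1/n} ξ x dx` of the cost function `c`. -/
def mean (c : ℕ → ℝ) : ℝ :=
  2 / entropyConst *
    ∑' n : ℕ, c (n + 1) * ∫ x in (1 / ((n : ℝ) + 2))..(1 / ((n : ℝ) + 1)), gaussDensity x

/-- The open disc of centre `2/3` and radius `1`. -/
def disc : Set ℂ := Metric.ball (2 / 3) 1

/-- The function on `ℂ` which equals `f` on the disc and `0` off the disc. -/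
def zeroExt (f : disc → ℂ) : ℂ → ℂ := Function.extend Subtype.val f 0

theorem zeroExt_apply (f : disc → ℂ) (z : disc) : zeroExt f z = f z :=
  Subtype.val_injective.extend_apply f 0 z

/-- The space of bounded holomorphic functions on the disc, with the uniform norm (which is
inherited from the space of bounded continuous functions). -/
def Hinf : Submodule ℂ (disc →ᵇ ℂ) where
  carrier := {f | DifferentiableOn ℂ (zeroExt f) disc}
  zero_mem' := by
    refine (differentiableOn_const (0 : ℂ)).congr fun z hz => ?_
    exact zeroExt_apply _ ⟨z, hz⟩
  add_mem' := by
    intro f g hf hg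
    refine (DifferentiableOn.add hf hg).congr fun z hz => ?_
    simp only [Pi.add_apply]
    rw [zeroExt_apply _ ⟨z, hz⟩, zeroExt_apply _ ⟨z, hz⟩, zeroExt_apply _ ⟨z, hz⟩]
    rfl
  smul_mem' := by
    intro a f hf
    refine (DifferentiableOn.const_smul hf a).congr fun z hz => ?_
    simp only [Pi.smul_apply]
    rw [zeroExt_apply _ ⟨z, hz⟩, zeroExt_apply _ ⟨z, hz⟩]
    rfl

/-- The value of an element of `Hinf` at a point of the disc (and `0` off the disc). -/
def hval (f : Hinf) : ℂ → ℂ := zeroExt f.1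

theorem Hinf.ext_hval {f g : Hinf} (h : ∀ z ∈ disc, hval f z = hval g z) : f = g := by
  apply Subtype.ext
  ext z
  have := h z z.2
  rwa [hval, hval, zeroExt_apply, zeroExt_apply] at this

/-- The weight `e^{ω c(n)} / (z + n)^{2s + μω}`. The principal branch is the right one, because
`z + n` has positive real part for `z` in the disc and `n ≥ 1`. -/
def weight (c : ℕ → ℝ) (s ω : ℂ) (n : ℕ) (z : ℂ) : ℂ :=
  Complex.exp (ω * (c n : ℂ)) / (z + (n : ℂ)) ^ (2 * s + (mean c : ℂ) * ω)

/-- `A` is the operator on `Hinf` with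
`(A f) z = ∑_{n ≥ m} e^{ω c(n)} / (z + n)^{2s + μω} * f (1 / (z + n))`,
the series converging at every point of the disc. -/
def IsTransferOp (c : ℕ → ℝ) (m : ℕ) (s ω : ℂ) (A : Hinf →L[ℂ] Hinf) : Prop :=
  ∀ (f : Hinf), ∀ z ∈ disc,
    HasSum (fun n : ℕ => weight c s ω (n + m) z * hval f (1 / (z + ((n + m : ℕ) : ℂ))))
      (hval (A f) z)

theorem IsTransferOp.unique {c : ℕ → ℝ} {m : ℕ} {s ω : ℂ} {A B : Hinf →L[ℂ] Hinf}
    (hA : IsTransferOp c m s ω A) (hB : IsTransferOp c m s ω B) : A = B := by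
  ext1 f
  exact Hinf.ext_hval fun z hz => (hA f z hz).unique (hB f z hz)

open Classical in
/-- The unique bounded operator on `Hinf` given by the series over `n ≥ m`, where there is one
(and `0` otherwise). -/
def transferOp (c : ℕ → ℝ) (m : ℕ) (s ω : ℂ) : Hinf →L[ℂ] Hinf :=
  if h : ∃ A, IsTransferOp c m s ω A then h.choose else 0

/-- The weighted Gauss-Kuzmin-Wirsing operator `𝓛_{s,ω}` (sum over `n ≥ 1`), as a function of
`p = (s, ω)`. -/
def opL (c : ℕ → ℝ) (p : ℂ × ℂ) : Hinf →L[ℂ] Hinf := transferOp c 1 p.1 p.2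

/-- The operator `𝓕_{s,ω}` (sum over `n ≥ 2`), as a function of `p = (s, ω)`. -/
def opF (c : ℕ → ℝ) (p : ℂ × ℂ) : Hinf →L[ℂ] Hinf := transferOp c 2 p.1 p.2

/-- Lebesgue measure on `[0,1]`. -/
def leb01 : Measure ℝ := volume.restrict (Set.Icc 0 1)

end GaussEuclid

end

open GaussEuclid

namespace GaussEuclid

noncomputable section

/-! ### The Banach space of bounded holomorphic functions on the disc -/

/-! Every inverse branch `1 / (z + n)` sends the disc into the concentric closed disc of radius 5/6,
so composition with it is compact: expand `f` in its Taylor series at 2/3. The factor `(z + n) ^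
(-w)` is the exponential of `w` times multiplication by `-log (z + n)`, so each branch operator is
entire in `w`, with norm locally uniformly `O(n ^ (-a))`, `a > 1`, when `Re w > 1`. The factors
`e^{ω c(n)}` are the coordinates of an exponential in the Banach algebra of bounded sequences. Hence
the series converges in norm and is jointly holomorphic where `Re (2s + μω) > 1`
(`exists_transferOp`); of `μ` only its being a constant matters.

At `(1, 0)` the density is fixed (a telescoping sum) and the integral is invariant (change of
variables on the intervals that tile `(0, 1]`). After multiplication by `1 + x` the operator
averages with positive weights of sum 1. A maximum principle then excludes eigenfunctions of
integral zero for eigenvalues of modulus at least 1 (`eq_zero_of_map_eq_smul`). By compactness, `L -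
∫ ⊗ ξ` has spectral radius below 1.

Near `(1, 0)` the eigenvalue is found by writing the operator as a rank-one perturbation and solving
a scalar equation with the implicit function theorem; the same resolvent gives the projection
(`exists_analytic_splitting`). The `L¹` statements follow from the tiling, one branch at a time. -/

theorem isOpen_disc : IsOpen disc := Metric.isOpen_ball

theorem nonempty_disc : Nonempty disc := ⟨⟨2 / 3, Metric.mem_ball_self one_pos⟩⟩

theorem hval_coe (f : Hinf) (z : disc) : hval f z = f.1 z := zeroExt_apply _ z

theorem hval_of_notMem (f : Hinf) {z : ℂ} (hz : z ∉ disc) : hval f z = 0 := by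
  rw [hval, zeroExt, Function.extend_apply' _ _ _ (by rintro ⟨a, rfl⟩; exact hz a.2)]
  rfl

theorem differentiableOn_hval (f : Hinf) : DifferentiableOn ℂ (hval f) disc := f.2

theorem norm_hval_le (f : Hinf) (z : ℂ) : ‖hval f z‖ ≤ ‖f‖ := by
  by_cases hz : z ∈ disc
  · rw [hval_coe f ⟨z, hz⟩]
    exact f.1.norm_coe_le_norm _
  · rw [hval_of_notMem f hz, norm_zero]
    exact norm_nonneg f

theorem hval_add (f g : Hinf) (z : ℂ) : hval (f + g) z = hval f z + hval g z := by
  by_cases hz : z ∈ disc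
  · simp only [hval_coe _ (⟨z, hz⟩ : disc)]
    rfl
  · simp only [hval_of_notMem _ hz, add_zero]

theorem hval_smul (a : ℂ) (f : Hinf) (z : ℂ) : hval (a • f) z = a * hval f z := by
  by_cases hz : z ∈ disc
  · simp only [hval_coe _ (⟨z, hz⟩ : disc)]
    rfl
  · simp only [hval_of_notMem _ hz, mul_zero]

theorem norm_le_of_hval {f : Hinf} {C : ℝ} (h : ∀ z ∈ disc, ‖hval f z‖ ≤ C) : ‖f‖ ≤ C := by
  have := nonempty_disc
  change ‖f.1‖ ≤ C
  rw [BoundedContinuousFunction.norm_le_of_nonempty]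
  intro z
  rw [← hval_coe]
  exact h z z.2

/-- Evaluation at a point, as a bounded functional on `Hinf`. -/
def evalAt (z : ℂ) : Hinf →L[ℂ] ℂ :=
  LinearMap.mkContinuous
    { toFun := fun f => hval f z
      map_add' := fun f g => hval_add f g z
      map_smul' := fun a f => hval_smul a f z } 1
    fun f => (norm_hval_le f z).trans_eq (one_mul _).symm

@[simp]
theorem evalAt_apply (z : ℂ) (f : Hinf) : evalAt z f = hval f z := rfl

theorem continuousOn_hval (f : Hinf) : ContinuousOn (hval f) disc :=
  (differentiableOn_hval f).continuousOn

/-- A bounded holomorphic function on the disc as an element of `Hinf`. -/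
def ofBounded (g : ℂ → ℂ) (hg : DifferentiableOn ℂ g disc) (C : ℝ)
    (hC : ∀ z ∈ disc, ‖g z‖ ≤ C) : Hinf :=
  ⟨BoundedContinuousFunction.ofNormedAddCommGroup (fun z : disc => g z)
      (continuousOn_iff_continuous_domRestrict.1 hg.continuousOn) C fun z => hC z z.2, by
    refine hg.congr fun z hz => ?_
    exact zeroExt_apply _ ⟨z, hz⟩⟩

theorem hval_ofBounded {g : ℂ → ℂ} {hg : DifferentiableOn ℂ g disc} {C : ℝ}
    {hC : ∀ z ∈ disc, ‖g z‖ ≤ C} {z : ℂ} (hz : z ∈ disc) : hval (ofBounded g hg C hC) z = g z :=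
  zeroExt_apply _ ⟨z, hz⟩

/-- Uniform limits of holomorphic functions are holomorphic, so `Hinf` is closed in the complete
space `disc →ᵇ ℂ`. -/
instance completeSpace_Hinf : CompleteSpace Hinf := by
  have : IsClosed (Hinf : Set (disc →ᵇ ℂ)) := by
    refine IsSeqClosed.isClosed fun u f hu hf => ?_
    rw [BoundedContinuousFunction.tendsto_iff_tendstoUniformly] at hf
    have h : TendstoUniformlyOn (fun n => zeroExt (u n)) (zeroExt f) atTop disc := by
      rw [Metric.tendstoUniformlyOn_iff]
      rw [Metric.tendstoUniformly_iff] at hf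
      intro ε hε
      filter_upwards [hf ε hε] with n hn z hz
      rw [zeroExt_apply _ ⟨z, hz⟩, zeroExt_apply _ ⟨z, hz⟩]
      exact hn ⟨z, hz⟩
    exact h.tendstoLocallyUniformlyOn.differentiableOn (Eventually.of_forall hu) isOpen_disc
  exact this.completeSpace_coe

/-- Composition with a holomorphic self-map of the disc followed by multiplication with a
bounded holomorphic function. -/
def weightedComp (h : Hinf) (ψ : ℂ → ℂ) (hψ : DifferentiableOn ℂ ψ disc)
    (hmaps : Set.MapsTo ψ disc disc) : Hinf →L[ℂ] Hinf :=
  LinearMap.mkContinuous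
    { toFun := fun f => ofBounded (fun z => hval h z * hval f (ψ z))
        ((differentiableOn_hval h).mul ((differentiableOn_hval f).comp hψ hmaps)) (‖h‖ * ‖f‖)
        fun z _ => by
          rw [norm_mul]
          exact mul_le_mul (norm_hval_le h z) (norm_hval_le f _) (norm_nonneg _) (norm_nonneg _)
      map_add' := fun f g => Hinf.ext_hval fun z hz => by
        simp only [hval_ofBounded hz, hval_add, mul_add]
      map_smul' := fun a f => Hinf.ext_hval fun z hz => by
        simp only [hval_ofBounded hz, hval_smul, RingHom.id_apply]
        ring } ‖h‖
    fun f => norm_le_of_hval fun z hz => by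
      simp only [LinearMap.coe_mk, AddHom.coe_mk, hval_ofBounded hz, norm_mul]
      exact mul_le_mul (norm_hval_le h z) (norm_hval_le f _) (norm_nonneg _) (norm_nonneg _)

theorem hval_weightedComp {h : Hinf} {ψ : ℂ → ℂ} {hψ : DifferentiableOn ℂ ψ disc}
    {hmaps : Set.MapsTo ψ disc disc} (f : Hinf) {z : ℂ} (hz : z ∈ disc) :
    hval (weightedComp h ψ hψ hmaps f) z = hval h z * hval f (ψ z) :=
  hval_ofBounded hz

/-- The operator of multiplication by a bounded holomorphic function. -/
def mulOp (h : Hinf) : Hinf →L[ℂ] Hinf :=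
  weightedComp h id differentiableOn_id (Set.mapsTo_id _)

theorem hval_mulOp (h f : Hinf) {z : ℂ} (hz : z ∈ disc) :
    hval (mulOp h f) z = hval h z * hval f z :=
  hval_weightedComp f hz

/-- Apply `φ` termwise to the exponential series. This evaluates exponentials both of operators and
of bounded sequences. -/
theorem map_exp_eq_of_map_pow_eq {A : Type*} [NormedRing A] [NormedAlgebra ℂ A] [CompleteSpace A]
    (φ : A →L[ℂ] ℂ) (x : A) (t a : ℂ) (h : ∀ n : ℕ, φ (x ^ n) = t ^ n * a) :
    φ (NormedSpace.exp x) = Complex.exp t * a := by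
  have h1 := (NormedSpace.exp_series_hasSum_exp' (𝕂 := ℂ) x).mapL φ
  have h2 := (NormedSpace.exp_series_hasSum_exp' (𝕂 := ℂ) t).mul_right a
  rw [← Complex.exp_eq_exp_ℂ] at h2
  have h3 : (fun n : ℕ => φ (((n.factorial : ℂ)⁻¹) • x ^ n)) =
      fun n : ℕ => ((n.factorial : ℂ)⁻¹ • t ^ n) * a := by
    funext n
    simp only [map_smul, h, smul_eq_mul, mul_assoc]
  exact h1.unique (h3 ▸ h2)

/-! ### Operator exponentials and compact sums. -/

section

variable {E : Type*} [NormedAddCommGroup E] [NormedSpace ℂ E] [CompleteSpace E]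

/-- The operator `exp (w A) B`. -/
def expMul (A B : E →L[ℂ] E) (w : ℂ) : E →L[ℂ] E :=
  (NormedSpace.exp (w • A)).comp B

theorem differentiable_expMul (A B : E →L[ℂ] E) : Differentiable ℂ (expMul A B) := by
  have h : Differentiable ℂ fun w : ℂ => NormedSpace.exp (w • A) := fun w =>
    (NormedSpace.exp_analytic (𝕂 := ℂ) (w • A)).differentiableAt.comp w
      (differentiableAt_id.smul_const A)
  exact fun w => (h w).clm_comp (differentiableAt_const B)

/-- `φ` is a left eigenvector of `A`. In the application `A` multiplies by a function, `φ` evaluates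
at a point, and `t` is the value there. -/
theorem map_expMul_apply (A B : E →L[ℂ] E) (φ : E →L[ℂ] ℂ) (t : ℂ)
    (h : ∀ f, φ (A f) = t * φ f) (w : ℂ) (f : E) :
    φ (expMul A B w f) = Complex.exp (w * t) * φ (B f) := by
  refine map_exp_eq_of_map_pow_eq (φ.comp (ContinuousLinearMap.apply ℂ E (B f)))
    (w • A) _ _ fun n => ?_
  change φ (((w • A) ^ n) (B f)) = _
  induction n with
  | zero => simp
  | succ n ih =>
    rw [pow_succ', mul_apply_eq_comp, smul_apply, map_smul, h, ih, smul_eq_mul]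
    ring

omit [CompleteSpace E] in
theorem isCompactOperator_expMul (A : E →L[ℂ] E) {B : E →L[ℂ] E} (hB : IsCompactOperator B)
    (w : ℂ) : IsCompactOperator (expMul A B w) :=
  hB.clm_comp _

theorem isCompactOperator_of_hasSum {T : ℕ → (E →L[ℂ] E)} {S : E →L[ℂ] E}
    (hT : ∀ n, IsCompactOperator (T n)) (hS : HasSum T S) : IsCompactOperator S := by
  refine isCompactOperator_of_tendsto hS (Eventually.of_forall fun s => ?_)
  exact (compactOperator (RingHom.id ℂ) E E).sum_mem fun i _ => hT i

omit [CompleteSpace E] in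
theorem isCompactOperator_smulRight (φ : E →L[ℂ] ℂ) (e : E) :
    IsCompactOperator (φ.smulRight e) :=
  IsCompactOperator.clm_comp (f := φ) (isCompactOperator_of_locallyCompactSpace_dom φ)
    (ContinuousLinearMap.toSpanSingleton ℂ e)

/-- The rank-one operators `φ k ⊗ e k` are absolutely summable, so their sum is compact. As the `δ
i` separate points, it suffices to compare this sum with `B` after each `δ i`. -/
theorem isCompactOperator_of_nuclear {ι : Type*} {φ : ℕ → (E →L[ℂ] ℂ)} {e : ℕ → E} {r : ℕ → ℝ}
    (hr : Summable r) (hφe : ∀ k, ‖φ k‖ * ‖e k‖ ≤ r k) {δ : ι → (E →L[ℂ] ℂ)}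
    (hδ : ∀ f g, (∀ i, δ i f = δ i g) → f = g) {B : E →L[ℂ] E}
    (hB : ∀ i f, HasSum (fun k => φ k f * δ i (e k)) (δ i (B f))) : IsCompactOperator B := by
  have hs : Summable fun k => (φ k).smulRight (e k) :=
    Summable.of_norm_bounded hr fun k =>
      (ContinuousLinearMap.norm_smulRight_apply (φ k) (e k)).trans_le (hφe k)
  have heq : ∑' k, (φ k).smulRight (e k) = B := by
    refine ContinuousLinearMap.ext fun f => hδ _ _ fun i => ?_
    have h := hs.hasSum.mapL ((δ i).comp (ContinuousLinearMap.apply ℂ E f))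
    have h' : HasSum (fun k => φ k f * δ i (e k))
        (δ i ((∑' k, (φ k).smulRight (e k) : E →L[ℂ] E) f)) := by
      simpa using h
    exact h'.unique (hB i f)
  rw [← heq]
  exact isCompactOperator_of_hasSum (fun k => isCompactOperator_smulRight (φ k) (e k)) hs.hasSum

end

/-! ### Holomorphic series with bounded coefficients. -/

section

variable {F : Type*} [NormedAddCommGroup F] [NormedSpace ℂ F] [CompleteSpace F]

/-- The linear map `a ↦ ∑ a n • v n` on bounded sequences, for `v` norm summable. -/
def seriesOp (v : ℕ → F) : (ℕ →ᵇ ℂ) →L[ℂ] F :=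
  ∑' n, (BoundedContinuousFunction.evalCLM ℂ n).smulRight (v n)

omit [CompleteSpace F] in
theorem norm_evalCLM_smulRight_le (n : ℕ) (v : F) :
    ‖((BoundedContinuousFunction.evalCLM ℂ n : (ℕ →ᵇ ℂ) →L[ℂ] ℂ)).smulRight v‖ ≤ ‖v‖ := by
  refine ContinuousLinearMap.opNorm_le_bound _ (norm_nonneg v) fun a => ?_
  rw [ContinuousLinearMap.smulRight_apply, norm_smul, mul_comm]
  exact mul_le_mul_of_nonneg_left (a.norm_coe_le_norm n) (norm_nonneg v)

theorem hasSum_seriesOp {v : ℕ → F} (hv : Summable fun n => ‖v n‖) (a : ℕ →ᵇ ℂ) :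
    HasSum (fun n => a n • v n) (seriesOp v a) := by
  have h : Summable fun n =>
      ((BoundedContinuousFunction.evalCLM ℂ n : (ℕ →ᵇ ℂ) →L[ℂ] ℂ)).smulRight (v n) :=
    Summable.of_norm_bounded hv fun n => norm_evalCLM_smulRight_le n (v n)
  exact h.hasSum.mapL (ContinuousLinearMap.apply ℂ F a)

theorem analyticAt_seriesOp {W : ℕ → ℂ → F} (hW : ∀ n, Differentiable ℂ (W n)) {O : Set ℂ}
    (hO : IsOpen O) {u : ℕ → ℝ} (hu : Summable u) (hWu : ∀ n, ∀ w ∈ O, ‖W n w‖ ≤ u n)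
    {w : ℂ} (hw : w ∈ O) : AnalyticAt ℂ (fun w => seriesOp fun n => W n w) w := by
  refine DifferentiableOn.analyticAt (s := O) ?_ (hO.mem_nhds hw)
  refine Complex.differentiableOn_tsum_of_summable_norm hu (fun n => ?_) hO fun n w hw =>
    (norm_evalCLM_smulRight_le n _).trans (hWu n w hw)
  exact ((ContinuousLinearMap.smulRightL ℂ (ℕ →ᵇ ℂ) F
    (BoundedContinuousFunction.evalCLM ℂ n)).differentiable.comp (hW n)).differentiableOn

theorem exp_apply_nat (a : ℕ →ᵇ ℂ) (ω : ℂ) (n : ℕ) :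
    (NormedSpace.exp (ω • a)) n = Complex.exp (ω * a n) := by
  have := map_exp_eq_of_map_pow_eq (BoundedContinuousFunction.evalCLM ℂ n) (ω • a) (ω * a n) 1
    fun k => by simp
  simpa using this

/-- The series is bilinear in the coefficient sequence `exp (ω • a)`, entire in `ω`, and the
operator `seriesOp` of the vectors, analytic by the Weierstrass test. Joint analyticity is thus a
composition of analytic maps. -/
theorem hasSum_and_analyticAt_weighted_series {W : ℕ → ℂ → F} (hW : ∀ n, Differentiable ℂ (W n))
    (hWu : ∀ w : ℂ, 1 < w.re → ∃ O : Set ℂ, IsOpen O ∧ w ∈ O ∧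
      ∃ u : ℕ → ℝ, Summable u ∧ ∀ n, ∀ w ∈ O, ‖W n w‖ ≤ u n)
    (a : ℕ →ᵇ ℂ) (m : ℂ) :
    ∃ Φ : ℂ × ℂ → F, ∀ p : ℂ × ℂ, 1 < (2 * p.1 + m * p.2).re →
      HasSum (fun n => Complex.exp (p.2 * a n) • W n (2 * p.1 + m * p.2)) (Φ p) ∧
        AnalyticAt ℂ Φ p := by
  refine ⟨fun p => seriesOp (fun n => W n (2 * p.1 + m * p.2)) (NormedSpace.exp (p.2 • a)),
    fun p hp => ?_⟩
  obtain ⟨O, hO, hpO, u, hu, hb⟩ := hWu _ hp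
  constructor
  · have := hasSum_seriesOp (v := fun n => W n (2 * p.1 + m * p.2))
      (hu.of_nonneg_of_le (fun _ => norm_nonneg _) fun n => hb n _ hpO)
      (NormedSpace.exp (p.2 • a))
    simpa only [exp_apply_nat] using this
  · have h1 : AnalyticAt ℂ (fun p : ℂ × ℂ => 2 * p.1 + m * p.2) p :=
      (analyticAt_const.mul analyticAt_fst).add (analyticAt_const.mul analyticAt_snd)
    have h2 : AnalyticAt ℂ (fun p : ℂ × ℂ => seriesOp fun n => W n (2 * p.1 + m * p.2)) p :=
      AnalyticAt.fun_comp (g := fun w => seriesOp fun n => W n w) (analyticAt_seriesOp hW hO hu hb hpO) h1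
    have h3 : AnalyticAt ℂ (fun p : ℂ × ℂ => p.2 • a) p := analyticAt_snd.smul analyticAt_const
    have h4 : AnalyticAt ℂ (fun p : ℂ × ℂ => NormedSpace.exp (p.2 • a)) p :=
      AnalyticAt.fun_comp (NormedSpace.exp_analytic (𝕂 := ℂ) _) h3
    exact AnalyticAt.comp₂ (ContinuousLinearMap.analyticAt_bilinear
      (ContinuousLinearMap.id ℂ ((ℕ →ᵇ ℂ) →L[ℂ] F)) _) h2 h4

end

/-! ### The inverse branches of the Gauss map on the disc -/

theorem neg_third_lt_re_of_mem_disc {z : ℂ} (hz : z ∈ disc) : -(1 / 3) < z.re := by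
  have h1 : ‖z - 2 / 3‖ < 1 := mem_ball_iff_norm.1 hz
  have h2 := (Complex.abs_re_le_norm (z - 2 / 3)).trans_lt h1
  have h3 : (z - 2 / 3).re = z.re - 2 / 3 := by simp
  rw [h3, abs_lt] at h2
  linarith [h2.1]

theorem ofReal_mem_disc {x : ℝ} (h0 : 0 ≤ x) (h1 : x ≤ 1) : (x : ℂ) ∈ disc := by
  have h : (x : ℂ) - 2 / 3 = ((x - 2 / 3 : ℝ) : ℂ) := by push_cast; rfl
  rw [disc, mem_ball_iff_norm, h, Complex.norm_real, Real.norm_eq_abs, abs_lt]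
  constructor <;> linarith

theorem two_thirds_mul_lt_re_add {z : ℂ} (hz : z ∈ disc) {n : ℕ} (hn : 1 ≤ n) :
    2 / 3 * (n : ℝ) < (z + n).re := by
  have h1 := neg_third_lt_re_of_mem_disc hz
  have h2 : (1 : ℝ) ≤ n := by exact_mod_cast hn
  rw [Complex.add_re, Complex.natCast_re]
  linarith

theorem two_thirds_lt_re_add {z : ℂ} (hz : z ∈ disc) {n : ℕ} (hn : 1 ≤ n) :
    2 / 3 < (z + n).re := by
  have h1 := two_thirds_mul_lt_re_add hz hn
  have h2 : (1 : ℝ) ≤ n := by exact_mod_cast hn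
  linarith

theorem add_natCast_ne_zero {z : ℂ} (hz : z ∈ disc) {n : ℕ} (hn : 1 ≤ n) : z + n ≠ 0 :=
  fun h => by
    have := two_thirds_lt_re_add hz hn
    rw [h, Complex.zero_re] at this
    linarith

/-- Inversion maps the half-plane `Re w ≥ 2/3` into the disc of centre 3/4 and radius 3/4. Moving
the centre to 2/3 costs 1/12, and 3/4 + 1/12 = 5/6. -/
theorem one_div_mem_closedBall {w : ℂ} (hw : 2 / 3 ≤ w.re) :
    1 / w ∈ Metric.closedBall (2 / 3 : ℂ) (5 / 6) := by
  have hw0 : w ≠ 0 := fun h => by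
    rw [h, Complex.zero_re] at hw
    linarith
  -- After squaring this is `16 ≤ 24 * Re w`.
  have h1 : ‖4 - 3 * w‖ ≤ 3 * ‖w‖ := by
    refine le_of_sq_le_sq ?_ (by positivity)
    rw [mul_pow, ← Complex.normSq_eq_norm_sq, ← Complex.normSq_eq_norm_sq, Complex.normSq_apply,
      Complex.normSq_apply]
    simp
    nlinarith
  have h2 : ‖1 / w - 3 / 4‖ ≤ 3 / 4 := by
    have h : 1 / w - 3 / 4 = (4 - 3 * w) / (4 * w) := by
      field_simp
    have hpos : 0 < ‖w‖ := norm_pos_iff.2 hw0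
    rw [h, norm_div, norm_mul, Complex.norm_ofNat, div_le_iff₀ (by positivity)]
    linarith
  rw [mem_closedBall_iff_norm]
  have h3 : 1 / w - 2 / 3 = (1 / w - 3 / 4) + (1 / 12 : ℝ) := by
    push_cast
    ring
  rw [h3]
  refine (norm_add_le _ _).trans ?_
  rw [Complex.norm_real]
  norm_num
  norm_num at h2
  linarith

theorem mapsTo_branch {n : ℕ} (hn : 1 ≤ n) :
    Set.MapsTo (fun z : ℂ => 1 / (z + n)) disc (Metric.closedBall (2 / 3) (5 / 6)) :=
  fun _ hz => one_div_mem_closedBall (two_thirds_lt_re_add hz hn).le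

theorem closedBall_subset_disc : Metric.closedBall (2 / 3 : ℂ) (5 / 6) ⊆ disc :=
  Metric.closedBall_subset_ball (by norm_num)

theorem differentiableOn_branch {n : ℕ} (hn : 1 ≤ n) :
    DifferentiableOn ℂ (fun z : ℂ => 1 / (z + n)) disc := fun z hz => by
  have := add_natCast_ne_zero hz hn
  exact DifferentiableAt.differentiableWithinAt (by fun_prop (disch := assumption))

/-! ### Compactness of composition operators -/

theorem analyticAt_hval (f : Hinf) {z : ℂ} (hz : z ∈ disc) : AnalyticAt ℂ (hval f) z :=
  (differentiableOn_hval f).analyticAt (isOpen_disc.mem_nhds hz)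

/-- Cauchy's estimate on the circle of radius 11/12. Any radius strictly between 5/6 and 1 would
serve. -/
theorem norm_taylorCoeff_le (k : ℕ) (f : Hinf) :
    ‖(k.factorial : ℂ)⁻¹ * iteratedDeriv k (hval f) (2 / 3)‖ ≤ (12 / 11) ^ k * ‖f‖ := by
  have h : ‖iteratedDeriv k (hval f) (2 / 3)‖ ≤ k.factorial * ‖f‖ / (11 / 12) ^ k := by
    refine Complex.norm_iteratedDeriv_le_of_forall_mem_sphere_norm_le k (by norm_num) ?_
      fun z _ => norm_hval_le f z
    refine DifferentiableOn.diffContOnCl ((differentiableOn_hval f).mono ?_)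
    rw [closure_ball _ (by norm_num)]
    exact Metric.closedBall_subset_ball (by norm_num)
  have hk : (0 : ℝ) < k.factorial := by exact_mod_cast k.factorial_pos
  rw [norm_mul, norm_inv, Complex.norm_natCast]
  calc (k.factorial : ℝ)⁻¹ * ‖iteratedDeriv k (hval f) (2 / 3)‖
      ≤ (k.factorial : ℝ)⁻¹ * (k.factorial * ‖f‖ / (11 / 12) ^ k) := by gcongr
    _ = (12 / 11) ^ k * ‖f‖ := by
      rw [show (12 / 11 : ℝ) = (11 / 12)⁻¹ by norm_num, inv_pow]
      generalize ‖f‖ = x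
      field_simp

/-- The Taylor coefficient at the centre of the disc. -/
def taylorCoeff (k : ℕ) : Hinf →L[ℂ] ℂ :=
  LinearMap.mkContinuous
    { toFun := fun f => (k.factorial : ℂ)⁻¹ * iteratedDeriv k (hval f) (2 / 3)
      map_add' := fun f g => by
        have h : hval (f + g) = hval f + hval g := funext fun z => hval_add f g z
        have hc : (2 / 3 : ℂ) ∈ disc := Metric.mem_ball_self one_pos
        rw [h, iteratedDeriv_add (analyticAt_hval f hc).contDiffAt
          (analyticAt_hval g hc).contDiffAt, mul_add]
      map_smul' := fun a f => by
        have h : hval (a • f) = fun z => a * hval f z := funext fun z => hval_smul a f z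
        rw [h, iteratedDeriv_const_mul_field, RingHom.id_apply, smul_eq_mul]
        ring } ((12 / 11) ^ k) (norm_taylorCoeff_le k)

theorem hasSum_taylorCoeff (f : Hinf) {z : ℂ} (hz : z ∈ disc) :
    HasSum (fun k => taylorCoeff k f * (z - 2 / 3) ^ k) (hval f z) := by
  have h := Complex.hasSum_taylorSeries_on_ball (differentiableOn_hval f) hz
  refine h.congr_fun fun k => ?_
  change (k.factorial : ℂ)⁻¹ * _ * _ = _
  simp only [smul_eq_mul]
  ring

/-- Composition with a holomorphic self-map of the disc. -/
def compOp (ψ : ℂ → ℂ) (hψ : DifferentiableOn ℂ ψ disc) (hmaps : Set.MapsTo ψ disc disc) :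
    Hinf →L[ℂ] Hinf :=
  weightedComp (ofBounded (fun _ => 1) (differentiableOn_const 1) 1 fun _ _ => by simp) ψ hψ hmaps

theorem hval_compOp {ψ : ℂ → ℂ} {hψ : DifferentiableOn ℂ ψ disc} {hmaps : Set.MapsTo ψ disc disc}
    (f : Hinf) {z : ℂ} (hz : z ∈ disc) : hval (compOp ψ hψ hmaps f) z = hval f (ψ z) := by
  rw [compOp, hval_weightedComp f hz, hval_ofBounded hz, one_mul]

/-- Substituting `ψ` in the Taylor series at 2/3 gives a nuclear expansion with ratio (12/11) *
(5/6) = 10/11. -/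
theorem isCompactOperator_compOp {ψ : ℂ → ℂ} (hψ : DifferentiableOn ℂ ψ disc)
    (hmaps : Set.MapsTo ψ disc (Metric.closedBall (2 / 3) (5 / 6))) :
    IsCompactOperator (compOp ψ hψ (hmaps.mono_right closedBall_subset_disc)) := by
  have hb : ∀ (k : ℕ), ∀ z ∈ disc, ‖(ψ z - 2 / 3) ^ k‖ ≤ (5 / 6) ^ k := fun k z hz => by
    rw [norm_pow]
    exact pow_le_pow_left₀ (norm_nonneg _) (mem_closedBall_iff_norm.1 (hmaps hz)) k
  set e : ℕ → Hinf := fun k =>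
    ofBounded (fun z => (ψ z - 2 / 3) ^ k) ((hψ.sub_const _).pow k) _ (hb k) with he
  have he_val : ∀ k, ∀ z ∈ disc, hval (e k) z = (ψ z - 2 / 3) ^ k := fun k z hz =>
    hval_ofBounded hz
  have hnorm : ∀ k, ‖taylorCoeff k‖ * ‖e k‖ ≤ (10 / 11) ^ k := fun k => by
    have h1 : ‖taylorCoeff k‖ ≤ (12 / 11) ^ k :=
      LinearMap.mkContinuous_norm_le _ (by positivity) _
    have h2 : ‖e k‖ ≤ (5 / 6) ^ k := norm_le_of_hval fun z hz => by
      rw [he_val k z hz]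
      exact hb k z hz
    calc ‖taylorCoeff k‖ * ‖e k‖ ≤ (12 / 11) ^ k * (5 / 6) ^ k :=
          mul_le_mul h1 h2 (norm_nonneg _) (by positivity)
      _ = (10 / 11) ^ k := by rw [← mul_pow]; norm_num
  refine isCompactOperator_of_nuclear (δ := fun z : disc => evalAt z)
    (summable_geometric_of_lt_one (by norm_num) (by norm_num)) hnorm
    (fun f g h => Hinf.ext_hval fun z hz => h ⟨z, hz⟩) fun z f => ?_
  simp only [evalAt_apply]
  rw [hval_compOp f z.2]
  simp only [he_val _ _ z.2]
  exact hasSum_taylorCoeff f (closedBall_subset_disc (hmaps z.2))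

/-! ### The transfer operators -/

/-- The logarithm is continuous on the closed disc, where `Re (z + n) > 0`, so compactness bounds
it. -/
theorem exists_hval_eq_neg_log {n : ℕ} (hn : 1 ≤ n) :
    ∃ h : Hinf, ∀ z ∈ disc, hval h z = -Complex.log (z + n) := by
  have hmem : ∀ z ∈ Metric.closedBall (2 / 3 : ℂ) 1, z + n ∈ Complex.slitPlane := fun z hz => by
    refine Or.inl ?_
    have h1 : ‖z - 2 / 3‖ ≤ 1 := mem_closedBall_iff_norm.1 hz
    have h2 := (Complex.abs_re_le_norm (z - 2 / 3)).trans h1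
    have h3 : (z - 2 / 3).re = z.re - 2 / 3 := by simp
    have h4 : (1 : ℝ) ≤ n := by exact_mod_cast hn
    rw [h3, abs_le] at h2
    rw [Complex.add_re, Complex.natCast_re]
    linarith [h2.1]
  have hd : DifferentiableOn ℂ (fun z : ℂ => -Complex.log (z + n)) (Metric.closedBall (2 / 3) 1) :=
    fun z hz => ((differentiableAt_id.add_const _).clog (hmem z hz)).neg.differentiableWithinAt
  obtain ⟨C, hC⟩ := (isCompact_closedBall (2 / 3 : ℂ) 1).exists_bound_of_continuousOn
    hd.continuousOn
  exact ⟨ofBounded _ (hd.mono Metric.ball_subset_closedBall) C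
    fun z hz => hC z (Metric.ball_subset_closedBall hz), fun z hz => hval_ofBounded hz⟩

theorem exists_branchOp {n : ℕ} (hn : 1 ≤ n) :
    ∃ W : ℂ → (Hinf →L[ℂ] Hinf), Differentiable ℂ W ∧ (∀ w, IsCompactOperator (W w)) ∧
      ∀ w f, ∀ z ∈ disc, hval (W w f) z = (z + n) ^ (-w) * hval f (1 / (z + n)) := by
  obtain ⟨h, hh⟩ := exists_hval_eq_neg_log hn
  refine ⟨expMul (mulOp h) (compOp _ (differentiableOn_branch hn)
    ((mapsTo_branch hn).mono_right closedBall_subset_disc)), differentiable_expMul _ _,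
    isCompactOperator_expMul _ (isCompactOperator_compOp _ (mapsTo_branch hn)), fun w f z hz => ?_⟩
  have := map_expMul_apply (mulOp h) (compOp _ (differentiableOn_branch hn)
    ((mapsTo_branch hn).mono_right closedBall_subset_disc)) (evalAt z) (hval h z)
    (fun f => hval_mulOp h f hz) w f
  rw [evalAt_apply, evalAt_apply, hval_compOp f hz, hh z hz] at this
  rw [this, Complex.cpow_def_of_ne_zero (add_natCast_ne_zero hz hn)]
  congr 2
  ring

/-- The bound is uniform for `w` in a truncated half-plane; `Real.exp (Real.pi * b)` absorbs the
argument of `z + n`. -/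
theorem norm_cpow_neg_le {z : ℂ} (hz : z ∈ disc) {n : ℕ} (hn : 1 ≤ n) {w : ℂ} {a b : ℝ}
    (ha : 0 < a) (haw : a ≤ w.re) (hwb : ‖w‖ ≤ b) :
    ‖(z + n) ^ (-w)‖ ≤ (3 / 2) ^ b * Real.exp (Real.pi * b) * (n : ℝ) ^ (-a) := by
  have h0 := two_thirds_mul_lt_re_add hz hn
  have hn1 : (1 : ℝ) ≤ n := by exact_mod_cast hn
  have hnorm : 2 / 3 * (n : ℝ) ≤ ‖z + n‖ := h0.le.trans (Complex.re_le_norm _)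
  rw [Complex.norm_cpow_of_ne_zero (add_natCast_ne_zero hz hn), div_eq_mul_inv, ← Real.exp_neg,
    Complex.neg_re, Complex.neg_im]
  have h1 : ‖z + n‖ ^ (-w.re) ≤ (3 / 2) ^ b * (n : ℝ) ^ (-a) := by
    calc ‖z + n‖ ^ (-w.re) ≤ (2 / 3 * (n : ℝ)) ^ (-w.re) :=
          Real.rpow_le_rpow_of_nonpos (by positivity) hnorm (by linarith)
      _ = (3 / 2) ^ w.re * (n : ℝ) ^ (-w.re) := by
          rw [Real.mul_rpow (by norm_num) (by positivity), Real.rpow_neg (by norm_num),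
            ← Real.inv_rpow (by norm_num)]
          norm_num
      _ ≤ (3 / 2) ^ b * (n : ℝ) ^ (-a) := by
          gcongr
          · norm_num
          · exact (Complex.re_le_norm w).trans hwb
  have h2 : Real.exp (-((z + n).arg * -w.im)) ≤ Real.exp (Real.pi * b) := by
    refine Real.exp_le_exp.2 ?_
    calc -((z + n).arg * -w.im) = (z + n).arg * w.im := by ring
      _ ≤ |(z + n).arg| * |w.im| := by rw [← abs_mul]; exact le_abs_self _
      _ ≤ Real.pi * b := by
        gcongr
        · exact Complex.abs_arg_le_pi _
        · exact (Complex.abs_im_le_norm w).trans hwb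
  calc _ ≤ (3 / 2) ^ b * (n : ℝ) ^ (-a) * Real.exp (Real.pi * b) := by gcongr
    _ = _ := by ring

theorem exists_transferOp (c : ℕ → ℝ) (hc_nonneg : ∀ n, 1 ≤ n → 0 ≤ c n)
    (hc_bdd : ∃ M : ℝ, ∀ n, 1 ≤ n → c n ≤ M) {m : ℕ} (hm : 1 ≤ m) :
    ∃ Φ : ℂ × ℂ → (Hinf →L[ℂ] Hinf), ∀ p : ℂ × ℂ, 1 < (2 * p.1 + (mean c : ℂ) * p.2).re →
      IsTransferOp c m p.1 p.2 (Φ p) ∧ IsCompactOperator (Φ p) ∧ AnalyticAt ℂ Φ p := by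
  obtain ⟨M, hM⟩ := hc_bdd
  have hm' : ∀ n, 1 ≤ n + m := fun n => by omega
  choose W hWd hWc hW using fun n => exists_branchOp (hm' n)
  have hWu : ∀ w : ℂ, 1 < w.re → ∃ O : Set ℂ, IsOpen O ∧ w ∈ O ∧
      ∃ u : ℕ → ℝ, Summable u ∧ ∀ n, ∀ w ∈ O, ‖W n w‖ ≤ u n := by
    intro w₀ hw₀
    -- A fixed exponent `a > 1` makes the majorant summable for all `w` near `w₀`.
    obtain ⟨a, ha1, haw⟩ := exists_between hw₀
    refine ⟨{w | a < w.re} ∩ {w | ‖w‖ < ‖w₀‖ + 1},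
      (isOpen_lt continuous_const Complex.continuous_re).inter
        (isOpen_lt continuous_norm continuous_const), ⟨haw, lt_add_one ‖w₀‖⟩,
      fun n => (3 / 2) ^ (‖w₀‖ + 1) * Real.exp (Real.pi * (‖w₀‖ + 1)) * ((n + m : ℕ) : ℝ) ^ (-a),
      ?_, ?_⟩
    · have h := Real.summable_nat_rpow.2 (neg_lt_neg ha1)
      exact ((summable_nat_add_iff m).2 h).mul_left _
    · rintro n w ⟨hw1, hw2⟩
      refine ContinuousLinearMap.opNorm_le_bound _ (by positivity) fun f => ?_
      refine norm_le_of_hval fun z hz => ?_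
      rw [hW n w f z hz, norm_mul]
      exact mul_le_mul (norm_cpow_neg_le hz (hm' n) (by linarith) (le_of_lt hw1) (le_of_lt hw2))
        (norm_hval_le f _) (norm_nonneg _) (by positivity)
  have hbound : ∀ n, ‖(c (n + m) : ℂ)‖ ≤ M := fun n => by
    rw [Complex.norm_real, Real.norm_eq_abs, abs_of_nonneg (hc_nonneg _ (hm' n))]
    exact hM _ (hm' n)
  set a : ℕ →ᵇ ℂ :=
    BoundedContinuousFunction.ofNormedAddCommGroupDiscrete (fun n => (c (n + m) : ℂ)) M hbound
  obtain ⟨Φ, hΦ⟩ := hasSum_and_analyticAt_weighted_series (F := Hinf →L[ℂ] Hinf) hWd hWu a (mean c : ℂ)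
  refine ⟨Φ, fun p hp => ⟨fun f z hz => ?_, ?_, (hΦ p hp).2⟩⟩
  · have h := (hΦ p hp).1.mapL ((evalAt z).comp (ContinuousLinearMap.apply ℂ Hinf f))
    refine h.congr_fun fun n => ?_
    change _ = hval (Complex.exp (p.2 * (c (n + m) : ℂ)) • W n (2 * p.1 + (mean c : ℂ) * p.2) f) z
    rw [hval_smul, hW n _ f z hz, weight, Complex.cpow_neg, div_eq_mul_inv, mul_assoc]
  · exact isCompactOperator_of_hasSum (fun n => (compactOperator (RingHom.id ℂ) Hinf Hinf).smul_mem _ (hWc n _)) (hΦ p hp).1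

/-- The pairs `(s, ω)` for which the series of the transfer operators converge absolutely. -/
def domainU (c : ℕ → ℝ) : Set (ℂ × ℂ) :=
  {p | 1 / 2 < p.1.re ∧ 1 < (2 * p.1 + (mean c : ℂ) * p.2).re}

theorem isOpen_domainU (c : ℕ → ℝ) : IsOpen (domainU c) :=
  IsOpen.and (isOpen_lt continuous_const (Complex.continuous_re.comp continuous_fst))
    (isOpen_lt continuous_const (Complex.continuous_re.comp
      ((continuous_const.mul continuous_fst).add (continuous_const.mul continuous_snd))))

theorem mem_domainU_zero (c : ℕ → ℝ) {s : ℂ} (hs : 1 / 2 < s.re) : (s, (0 : ℂ)) ∈ domainU c := by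
  refine ⟨hs, ?_⟩
  simp
  linarith

/-- `transferOp` is a pointwise choice; uniqueness identifies it with the analytic family. -/
theorem transferOp_properties (c : ℕ → ℝ) (hc_nonneg : ∀ n, 1 ≤ n → 0 ≤ c n)
    (hc_bdd : ∃ M : ℝ, ∀ n, 1 ≤ n → c n ≤ M) {m : ℕ} (hm : 1 ≤ m) :
    (∀ p ∈ domainU c, IsTransferOp c m p.1 p.2 (transferOp c m p.1 p.2) ∧
      IsCompactOperator (transferOp c m p.1 p.2)) ∧
    AnalyticOnNhd ℂ (fun p : ℂ × ℂ => transferOp c m p.1 p.2) (domainU c) := by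
  obtain ⟨Φ, hΦ⟩ := exists_transferOp c hc_nonneg hc_bdd hm
  have hspec : ∀ p ∈ domainU c, IsTransferOp c m p.1 p.2 (transferOp c m p.1 p.2) :=
    fun p hp => by
      have h : ∃ A, IsTransferOp c m p.1 p.2 A := ⟨_, (hΦ p hp.2).1⟩
      rw [transferOp, dif_pos h]
      exact h.choose_spec
  have heq : Set.EqOn Φ (fun p : ℂ × ℂ => transferOp c m p.1 p.2) (domainU c) := fun p hp =>
    (hΦ p hp.2).1.unique (hspec p hp)
  refine ⟨fun p hp => ⟨hspec p hp, ?_⟩,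
    AnalyticOnNhd.congr (isOpen_domainU c) (fun p hp => (hΦ p hp.2).2.2) heq⟩
  exact (show Φ p = transferOp c m p.1 p.2 from heq hp) ▸ (hΦ p hp.2).2.1

/-! ### Analytic perturbation of a simple dominant eigenvalue -/

section

variable {E : Type*} [NormedAddCommGroup E] [NormedSpace ℂ E]

/-- The algebraic splitting `T = lam P + N` with a rank one projection `P` onto the eigenspace. -/
def IsRankOneSplitting (T : E →L[ℂ] E) (lam : ℂ) (P N : E →L[ℂ] E) : Prop :=
  T = lam • P + N ∧ P.comp N = 0 ∧ N.comp P = 0 ∧ P.comp P = P ∧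
    Module.finrank ℂ (LinearMap.range (P : E →ₗ[ℂ] E)) = 1 ∧
    LinearMap.range (P : E →ₗ[ℂ] E) = Module.End.eigenspace (T : E →ₗ[ℂ] E) lam

/-- If `R` inverts `lam - (T - ξ ⊗ l)` and `l (R ξ) = 1`, then `lam` is an eigenvalue of `T` with
eigenvector `R ξ` and left eigenvector `l ∘ R`. -/
theorem isRankOneSplitting_of_inverse {T R : E →L[ℂ] E} {lam : ℂ} {ξ : E} {l : E →L[ℂ] ℂ}
    (h1 : R * (lam • 1 - (T - l.smulRight ξ)) = 1)
    (h2 : (lam • 1 - (T - l.smulRight ξ)) * R = 1) (hF : l (R ξ) = 1) (hd : l (R (R ξ)) ≠ 0) :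
    IsRankOneSplitting T lam ((l (R (R ξ)))⁻¹ • (l.comp R).smulRight (R ξ))
      (T - lam • (l (R (R ξ)))⁻¹ • (l.comp R).smulRight (R ξ)) := by
  set d := l (R (R ξ)) with hd'
  set P : E →L[ℂ] E := d⁻¹ • (l.comp R).smulRight (R ξ) with hP
  have hPf : ∀ f, P f = (d⁻¹ * l (R f)) • R ξ := fun f => by
    simp [hP, smul_smul]
  -- `e1` and `e2` are the two inverse relations solved for `R T` and `T R`. With `l (R ξ) = 1` they
  -- make `R ξ` a right eigenvector and `l ∘ R` a left one.
  have e1 : ∀ f, R (T f) = lam • R f - f + l f • R ξ := fun f => by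
    have := DFunLike.congr_fun h1 f
    simp only [mul_apply_eq_comp, sub_apply, smul_apply, one_apply_eq_self, map_sub,
      map_smul, ContinuousLinearMap.smulRight_apply] at this
    rw [← sub_eq_zero] at this ⊢
    rw [← neg_eq_zero, ← this]
    abel
  have e2 : ∀ f, T (R f) = lam • R f - f + l (R f) • ξ := fun f => by
    have := DFunLike.congr_fun h2 f
    simp only [mul_apply_eq_comp, sub_apply, smul_apply, one_apply_eq_self,
      ContinuousLinearMap.smulRight_apply] at this
    rw [← sub_eq_zero] at this ⊢
    rw [← neg_eq_zero, ← this]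
    abel
  have hTR : T (R ξ) = lam • R ξ := by rw [e2, hF, one_smul, sub_add_cancel]
  have hlT : ∀ f, l (R (T f)) = lam * l (R f) := fun f => by
    rw [e1]
    simp [hF]
  have hPh : P (R ξ) = R ξ := by rw [hPf, inv_mul_cancel₀ hd, one_smul]
  have hTP : T.comp P = lam • P := by
    ext f
    simp only [ContinuousLinearMap.comp_apply, smul_apply, hPf, map_smul, hTR]
    rw [smul_comm]
  have hPT : P.comp T = lam • P := by
    ext f
    simp only [ContinuousLinearMap.comp_apply, smul_apply, hPf, hlT, smul_smul]
    congr 1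
    ring
  have hPP : P.comp P = P := by
    ext f
    rw [ContinuousLinearMap.comp_apply, hPf f, map_smul, hPh]
  have hne : R ξ ≠ 0 := fun h => by simp [h] at hF
  have hrange : LinearMap.range (P : E →ₗ[ℂ] E) = Submodule.span ℂ {R ξ} := by
    ext f
    rw [Submodule.mem_span_singleton, LinearMap.mem_range]
    constructor
    · rintro ⟨g, rfl⟩
      exact ⟨_, (hPf g).symm⟩
    · rintro ⟨a, rfl⟩
      exact ⟨a • R ξ, by rw [ContinuousLinearMap.coe_coe, map_smul, hPh]⟩
  refine ⟨by abel, ?_, ?_, hPP, ?_, ?_⟩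
  · rw [ContinuousLinearMap.comp_sub, hPT, ContinuousLinearMap.comp_smul, hPP, sub_self]
  · rw [ContinuousLinearMap.sub_comp, hTP, ContinuousLinearMap.smul_comp, hPP, sub_self]
  · rw [hrange, finrank_span_singleton hne]
  · rw [hrange]
    ext f
    rw [Submodule.mem_span_singleton, Module.End.mem_eigenspace_iff, ContinuousLinearMap.coe_coe]
    constructor
    · rintro ⟨a, rfl⟩
      rw [map_smul, hTR, smul_comm]
    · intro hf
      -- For `T f = lam • f`, `e1` reduces to `f = l f • R ξ`.
      refine ⟨l f, ?_⟩
      have := e1 f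
      rw [hf, map_smul, eq_comm, sub_add, sub_eq_self, sub_eq_zero] at this
      exact this.symm

variable [CompleteSpace E]

/-- Upper semicontinuity of the spectrum: nearby spectra stay in the open ball of radius `r`. -/
theorem eventually_spectralRadius_lt (A : E →L[ℂ] E) {r : NNReal}
    (hr : spectralRadius ℂ A < r) : ∀ᶠ B in 𝓝 A, spectralRadius ℂ B ≤ r := by
  have h : Metric.ball (0 : ℂ) r ∈ nhdsSet (spectrum ℂ A) := by
    refine Metric.isOpen_ball.mem_nhdsSet.2 fun z hz => ?_
    have : (‖z‖₊ : ENNReal) < r :=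
      lt_of_le_of_lt (le_iSup₂ (f := fun k (_ : k ∈ spectrum ℂ A) => (‖k‖₊ : ENNReal)) z hz) hr
    rw [ENNReal.coe_lt_coe] at this
    exact mem_ball_zero_iff.2 this
  filter_upwards [upperHemicontinuous_spectrum ℂ (E →L[ℂ] E) A _ h] with B hB
  refine iSup₂_le fun z hz => ?_
  have := mem_ball_zero_iff.1 (subset_of_mem_nhdsSet hB hz)
  exact ENNReal.coe_le_coe.2 (le_of_lt this)

/-- With `K = l ⊗ ξ` and `R` the inverse of `lam - (T - K)`, a solution of `l (R ξ) = 1` is an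
eigenvalue of `T`. At `p₀` the left side is `1 / lam`, with derivative `-1` at 1, so the implicit
function theorem gives an analytic root. -/
theorem exists_analytic_splitting {G : Type*} [NormedAddCommGroup G] [NormedSpace ℂ G]
    [CompleteSpace G] {T : G → (E →L[ℂ] E)} {p₀ : G} (hT : AnalyticAt ℂ T p₀) {ξ : E}
    {l : E →L[ℂ] ℂ} (hlξ : l ξ = 1) (hξ : T p₀ ξ = ξ) (hl : ∀ f, l (T p₀ f) = l f)
    (hρ : spectralRadius ℂ (T p₀ - l.smulRight ξ) < 1) :
    ∃ (lam : G → ℂ) (P N : G → (E →L[ℂ] E)),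
      AnalyticAt ℂ lam p₀ ∧ AnalyticAt ℂ P p₀ ∧ AnalyticAt ℂ N p₀ ∧
      lam p₀ = 1 ∧ P p₀ = l.smulRight ξ ∧
      ∀ᶠ p in 𝓝 p₀, IsRankOneSplitting (T p) (lam p) (P p) (N p) ∧
        spectralRadius ℂ (N p) < 1 ∧ spectralRadius ℂ (N p) < ‖lam p‖ₑ := by
  set K : E →L[ℂ] E := l.smulRight ξ with hK
  set D : G × ℂ → (E →L[ℂ] E) := fun q => q.2 • 1 - (T q.1 - K) with hD
  have hDan : AnalyticAt ℂ D (p₀, 1) := by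
    refine (analyticAt_snd.smul analyticAt_const).sub (AnalyticAt.sub ?_ analyticAt_const)
    exact AnalyticAt.fun_comp (g := T) hT analyticAt_fst
  have hunit : IsUnit (D (p₀, 1)) := by
    have : (1 : ℂ) ∈ resolventSet ℂ (T p₀ - K) :=
      spectrum.mem_resolventSet_of_spectralRadius_lt (by simpa using hρ)
    rwa [spectrum.mem_resolventSet_iff, Algebra.algebraMap_eq_smul_one] at this
  set R : G × ℂ → (E →L[ℂ] E) := fun q => Ring.inverse (D q) with hR
  have hRan : AnalyticAt ℂ R (p₀, 1) := by
    obtain ⟨u, hu⟩ := hunit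
    refine AnalyticAt.fun_comp (g := Ring.inverse) ?_ hDan
    rw [← hu]
    exact analyticAt_inverse u
  have hunits : ∀ᶠ q in 𝓝 (p₀, (1 : ℂ)), IsUnit (D q) := by
    obtain ⟨u, hu⟩ := hunit
    have := hDan.continuousAt.eventually (Units.isOpen.mem_nhds ⟨u, hu⟩)
    exact this
  have hinv : ∀ q, IsUnit (D q) → R q * D q = 1 ∧ D q * R q = 1 := fun q hq =>
    ⟨Ring.inverse_mul_cancel _ hq, Ring.mul_inverse_cancel _ hq⟩
  set F : G × ℂ → ℂ := fun q => l (R q ξ) with hF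
  have hφ : ∀ {H : Type _} [NormedAddCommGroup H] [NormedSpace ℂ H] {S : H → (E →L[ℂ] E)} {q : H},
      AnalyticAt ℂ S q → AnalyticAt ℂ (fun q => l (S q ξ)) q := fun {H} _ _ {S q} hS =>
    AnalyticAt.fun_comp (g := fun A : E →L[ℂ] E => l (A ξ))
      ((l.comp (ContinuousLinearMap.apply ℂ E ξ)).analyticAt _) hS
  have hFan : AnalyticAt ℂ F (p₀, 1) := hφ hRan
  have hFlam : ∀ z : ℂ, z ≠ 0 → IsUnit (D (p₀, z)) → F (p₀, z) = z⁻¹ := fun z hz hu => by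
    have hDξ : D (p₀, z) ξ = z • ξ := by
      simp [hD, hK, hξ, hlξ]
    have h := DFunLike.congr_fun (hinv _ hu).1 ξ
    rw [mul_apply_eq_comp, hDξ, map_smul, one_apply_eq_self] at h
    have h' := congrArg l h
    rw [map_smul, hlξ, smul_eq_mul] at h'
    exact eq_inv_of_mul_eq_one_right h'
  have hF1 : F (p₀, 1) = 1 := by rw [hFlam 1 one_ne_zero hunit, inv_one]
  have hcd : ContDiffAt ℂ ⊤ F (p₀, 1) := hFan.contDiffAt
  have hpartial : (fderiv ℂ F (p₀, 1)).comp (ContinuousLinearMap.inr ℂ G ℂ) =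
      ((ContinuousLinearEquiv.neg ℂ : ℂ ≃L[ℂ] ℂ) : ℂ →L[ℂ] ℂ) := by
    have hc : HasFDerivAt (fun z : ℂ => ((p₀, z) : G × ℂ)) (ContinuousLinearMap.inr ℂ G ℂ) 1 :=
      hasFDerivAt_prodMk_right p₀ 1
    have h3 := HasFDerivAt.comp (1 : ℂ) hFan.differentiableAt.hasFDerivAt hc
    have h4 : (F ∘ fun z : ℂ => ((p₀, z) : G × ℂ)) =ᶠ[𝓝 1] fun z => z⁻¹ := by
      filter_upwards [eventually_ne_nhds one_ne_zero, hc.continuousAt.eventually hunits]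
        with z hz hu using hFlam z hz hu
    have h5 := (hasDerivAt_inv (one_ne_zero (α := ℂ))).hasFDerivAt.congr_of_eventuallyEq h4
    refine (h3.unique h5).trans ?_
    ext
    simp
  have hinvert : ((fderiv ℂ F (p₀, 1)).comp (ContinuousLinearMap.inr ℂ G ℂ)).IsInvertible :=
    ⟨_, hpartial.symm⟩
  set lam := hcd.implicitFunction (by simp) hinvert with hlam
  have hlam0 : lam p₀ = 1 := hcd.implicitFunction_apply_self (by simp) hinvert
  have hlaman : AnalyticAt ℂ lam p₀ :=
    (hcd.contDiffAt_implicitFunction (by simp) hinvert).analyticAt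
  have hFeq : ∀ᶠ p in 𝓝 p₀, F (p, lam p) = 1 := by
    have := hcd.eventually_apply_implicitFunction (by simp) hinvert
    rwa [hF1] at this
  have hpair : AnalyticAt ℂ (fun p => (p, lam p)) p₀ := AnalyticAt.prod analyticAt_id hlaman
  set S : G → (E →L[ℂ] E) := fun p => R (p, lam p) with hS
  have hSan : AnalyticAt ℂ S p₀ :=
    AnalyticAt.fun_comp (g := R) (by rw [hlam0]; exact hRan) hpair
  have hunits' : ∀ᶠ p in 𝓝 p₀, IsUnit (D (p, lam p)) := by
    have h : Tendsto (fun p => (p, lam p)) (𝓝 p₀) (𝓝 (p₀, 1)) := by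
      have := hpair.continuousAt.tendsto
      rwa [hlam0] at this
    exact h.eventually hunits
  set d : G → ℂ := fun p => l (S p (S p ξ)) with hd
  have hdan : AnalyticAt ℂ d p₀ := hφ (hSan.mul hSan)
  set P : G → (E →L[ℂ] E) := fun p => (d p)⁻¹ • (l.comp (S p)).smulRight (S p ξ) with hP
  -- `T p₀ - K` kills `ξ` and is killed by `l`, so its resolvent at 1 fixes both; hence `P p₀ = K`.
  have hlS : ∀ f, l (S p₀ f) = l f := fun f => by
    have h := DFunLike.congr_fun (hinv _ hunits'.self_of_nhds).2 f
    have h' := congrArg l h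
    simpa [hS, hD, hlam0, hK, hl, hlξ] using h'
  have hSξ : S p₀ ξ = ξ := by
    have h := DFunLike.congr_fun (hinv _ hunits'.self_of_nhds).1 ξ
    simpa [hS, hD, hlam0, hK, hξ, hlξ] using h
  have hd0 : d p₀ = 1 := by simp only [hd, hSξ, hlξ]
  have hP0 : P p₀ = K := by
    ext f
    simp [hP, hd0, hlS, hSξ, hK]
  have hPan : AnalyticAt ℂ P p₀ := by
    have h : P = fun p => (d p)⁻¹ • (S p * K * S p) := by
      funext p
      ext f
      simp [hP, hK]
    rw [h]
    exact (hdan.inv (by simp [hd0])).smul ((hSan.mul analyticAt_const).mul hSan)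
  set N : G → (E →L[ℂ] E) := fun p => T p - lam p • P p with hN
  have hNan : AnalyticAt ℂ N p₀ := hT.sub (hlaman.smul hPan)
  refine ⟨lam, P, N, hlaman, hPan, hNan, hlam0, hP0, ?_⟩
  -- One number `r < 1` separates the spectral radius of `N p` from both 1 and `‖lam p‖`.
  obtain ⟨r, hr1, hr2⟩ := ENNReal.lt_iff_exists_nnreal_btwn.1 hρ
  have hN0 : N p₀ = T p₀ - K := by simp only [hN, hlam0, hP0, one_smul]
  have hspec : ∀ᶠ p in 𝓝 p₀, spectralRadius ℂ (N p) ≤ r :=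
    hNan.continuousAt.eventually (eventually_spectralRadius_lt _ (by rwa [hN0]))
  have hlamr : ∀ᶠ p in 𝓝 p₀, (r : ENNReal) < ‖lam p‖ₑ := by
    refine hlaman.continuousAt.enorm.eventually (lt_mem_nhds ?_)
    simpa [hlam0] using hr2
  have hdne : ∀ᶠ p in 𝓝 p₀, d p ≠ 0 :=
    hdan.continuousAt.eventually_ne (by simp [hd0])
  filter_upwards [hspec, hlamr, hdne, hunits', hFeq] with p h1 h2 h3 h4 h5
  exact ⟨isRankOneSplitting_of_inverse (hinv _ h4).1 (hinv _ h4).2 h5 h3,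
    h1.trans_lt hr2, h1.trans_lt h2⟩

end

/-! ### The Gauss-Kuzmin-Wirsing operator on `L¹([0,1])` -/

/-- The inverse branch `x ↦ 1 / (x + n + 1)` of the Gauss map. -/
def branch (n : ℕ) (x : ℝ) : ℝ := 1 / (x + ((n + 1 : ℕ) : ℝ))

/-- The image of `[0, 1)` under an inverse branch. -/
def branchIoc (n : ℕ) : Set ℝ :=
  Set.Ioc (1 / ((n + 1 : ℕ) + 1 : ℝ)) (1 / ((n : ℕ) + 1 : ℝ))

/-- Half-open intervals make the tiling exact: `branch n` maps `[0, 1)` onto `branchIoc n`, and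
these sets partition `(0, 1]`. -/
theorem leb01_eq_Ico : leb01 = volume.restrict (Set.Ico 0 1) :=
  Measure.restrict_congr_set Ico_ae_eq_Icc.symm

theorem leb01_eq_Ioc : leb01 = volume.restrict (Set.Ioc 0 1) :=
  Measure.restrict_congr_set Ioc_ae_eq_Icc.symm

theorem ae_mem_Ico : ∀ᵐ x ∂leb01, x ∈ Set.Ico (0 : ℝ) 1 := by
  rw [leb01_eq_Ico]
  exact ae_restrict_mem measurableSet_Ico

theorem iUnion_branchIoc : ⋃ n, branchIoc n = Set.Ioc 0 1 := by
  ext x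
  simp only [Set.mem_iUnion, branchIoc, Set.mem_Ioc]
  constructor
  · rintro ⟨n, h1, h2⟩
    refine ⟨lt_trans (by positivity) h1, h2.trans ?_⟩
    rw [div_le_one (by positivity)]
    exact le_add_of_nonneg_left (Nat.cast_nonneg n)
  · rintro ⟨h0, h1⟩
    have hk : 1 ≤ ⌊1 / x⌋₊ := Nat.one_le_floor_iff _ |>.2 ((one_le_div h0).2 h1)
    obtain ⟨n, hn⟩ := Nat.exists_eq_add_of_le' hk
    have h2 := Nat.floor_le (one_div_pos.2 h0).le
    have h3 := Nat.lt_floor_add_one (1 / x)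
    rw [hn] at h2 h3
    refine ⟨n, ?_, ?_⟩
    · rw [div_lt_comm₀ (by positivity) h0]
      exact h3
    · rw [le_div_comm₀ h0 (by positivity)]
      exact_mod_cast h2

theorem pairwise_disjoint_branchIoc : Pairwise (Function.onFun Disjoint branchIoc) := by
  have h : Antitone fun n : ℕ => 1 / ((n : ℝ) + 1) := fun m n hmn => by
    have : (m : ℝ) ≤ n := by exact_mod_cast hmn
    exact one_div_le_one_div_of_le (by positivity) (by linarith)
  exact h.pairwise_disjoint_on_Ioc_succ

theorem measurableSet_branchIoc (n : ℕ) : MeasurableSet (branchIoc n) := measurableSet_Ioc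

theorem branch_injOn (n : ℕ) : Set.InjOn (branch n) (Set.Ico 0 1) := fun x _ y _ h => by
  simpa [branch] using h

theorem image_branch (n : ℕ) : branch n '' Set.Ico 0 1 = branchIoc n := by
  ext y
  simp only [Set.mem_image, Set.mem_Ico, branchIoc, Set.mem_Ioc, branch]
  have hn : (0 : ℝ) < n + 1 := by positivity
  constructor
  · rintro ⟨x, ⟨h0, h1⟩, rfl⟩
    push_cast
    constructor
    · exact one_div_lt_one_div_of_lt (by positivity) (by linarith)
    · exact one_div_le_one_div_of_le hn (by linarith)
  · rintro ⟨h1, h2⟩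
    have hy : 0 < y := lt_trans (by positivity) h1
    rw [div_lt_comm₀ (by positivity) hy] at h1
    rw [le_div_comm₀ hy hn] at h2
    push_cast at h1 ⊢
    exact ⟨1 / y - (n + 1), ⟨by linarith, by linarith⟩, by simp⟩

theorem hasDerivAt_branch (n : ℕ) {x : ℝ} (hx : 0 ≤ x) :
    HasDerivAt (branch n) (-1 / (x + ((n + 1 : ℕ) : ℝ)) ^ 2) x := by
  have h : x + ((n + 1 : ℕ) : ℝ) ≠ 0 := by positivity
  have := ((hasDerivAt_id x).add_const ((n + 1 : ℕ) : ℝ)).inv h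
  refine this.congr_of_eventuallyEq (Eventually.of_forall fun y => ?_)
  simp [branch]

theorem gaussMap_branch (n : ℕ) {x : ℝ} (hx : x ∈ Set.Ico (0 : ℝ) 1) :
    gaussMap (branch n x) = x := by
  have h : 1 / branch n x = x + ((n + 1 : ℕ) : ℝ) := by rw [branch, one_div_one_div]
  rw [gaussMap, h, Int.floor_add_natCast, Int.floor_eq_zero_iff.2 hx]
  push_cast
  ring

/-- The summand of the Gauss-Kuzmin-Wirsing operator. -/
def gaussTerm (n : ℕ) (f : ℝ → ℂ) (x : ℝ) : ℂ :=
  |-1 / (x + ((n + 1 : ℕ) : ℝ)) ^ 2| • f (branch n x)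

theorem integrable_gaussTerm (n : ℕ) {f : ℝ → ℂ} (hf : Integrable f leb01) :
    Integrable (gaussTerm n f) leb01 := by
  rw [leb01_eq_Ioc, ← iUnion_branchIoc] at hf
  have h : IntegrableOn f (branchIoc n) := hf.mono_measure
    (Measure.restrict_mono (Set.subset_iUnion _ n) le_rfl)
  rw [← image_branch, integrableOn_image_iff_integrableOn_abs_deriv_smul measurableSet_Ico
    (fun x hx => (hasDerivAt_branch n hx.1).hasDerivWithinAt) (branch_injOn n)] at h
  rw [leb01_eq_Ico]
  exact h

theorem integral_gaussTerm (n : ℕ) (f : ℝ → ℂ) :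
    ∫ x, gaussTerm n f x ∂leb01 = ∫ x in branchIoc n, f x := by
  rw [leb01_eq_Ico, ← image_branch, integral_image_eq_integral_abs_deriv_smul measurableSet_Ico
    (fun x hx => (hasDerivAt_branch n hx.1).hasDerivWithinAt) (branch_injOn n)]
  rfl

theorem integral_norm_gaussTerm (n : ℕ) (f : ℝ → ℂ) :
    ∫ x, ‖gaussTerm n f x‖ ∂leb01 = ∫ x in branchIoc n, ‖f x‖ := by
  rw [leb01_eq_Ico, ← image_branch, integral_image_eq_integral_abs_deriv_smul measurableSet_Ico
    (fun x hx => (hasDerivAt_branch n hx.1).hasDerivWithinAt) (branch_injOn n)]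
  simp only [gaussTerm, norm_smul, Real.norm_eq_abs, abs_abs, smul_eq_mul]

theorem hasSum_integral_branchIoc {G : Type*} [NormedAddCommGroup G] [NormedSpace ℝ G]
    {f : ℝ → G} (hf : Integrable f leb01) :
    HasSum (fun n => ∫ x in branchIoc n, f x) (∫ x, f x ∂leb01) := by
  rw [leb01_eq_Ioc, ← iUnion_branchIoc] at hf ⊢
  exact hasSum_integral_iUnion measurableSet_branchIoc pairwise_disjoint_branchIoc hf

/-- By change of variables the difference has `L¹` norm zero; this makes the summand well defined on
classes. -/
theorem gaussTerm_congr_ae (n : ℕ) {f g : ℝ → ℂ} (hf : Integrable f leb01)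
    (hfg : f =ᵐ[leb01] g) : gaussTerm n f =ᵐ[leb01] gaussTerm n g := by
  have hg : Integrable g leb01 := hf.congr hfg
  have h0 : ∫ x, ‖gaussTerm n (f - g) x‖ ∂leb01 = 0 := by
    rw [integral_norm_gaussTerm, ← integral_zero ℝ ℝ (μ := volume.restrict (branchIoc n))]
    refine integral_congr_ae ?_
    have hle : volume.restrict (branchIoc n) ≤ leb01 := by
      rw [leb01_eq_Ioc, ← iUnion_branchIoc]
      exact Measure.restrict_mono (Set.subset_iUnion _ n) le_rfl
    filter_upwards [ae_mono hle hfg] with x hx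
    simp [hx]
  rw [integral_eq_zero_iff_of_nonneg (fun _ => norm_nonneg _)
    (integrable_gaussTerm n (hf.sub hg)).norm] at h0
  filter_upwards [h0] with x hx
  have h : gaussTerm n (f - g) x = 0 := norm_eq_zero.1 hx
  rw [← sub_eq_zero, ← h]
  simp only [gaussTerm, Pi.sub_apply, smul_sub]

/-- The summand of the Gauss-Kuzmin-Wirsing operator, acting on `L¹`. -/
def gaussTermL1 (n : ℕ) (f : ℝ →₁[leb01] ℂ) : ℝ →₁[leb01] ℂ :=
  (integrable_gaussTerm n (L1.integrable_coeFn f)).toL1 _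

theorem coeFn_gaussTermL1 (n : ℕ) (f : ℝ →₁[leb01] ℂ) :
    gaussTermL1 n f =ᵐ[leb01] gaussTerm n f :=
  Integrable.coeFn_toL1 _

theorem gaussTermL1_add (n : ℕ) (f g : ℝ →₁[leb01] ℂ) :
    gaussTermL1 n (f + g) = gaussTermL1 n f + gaussTermL1 n g := by
  rw [gaussTermL1, gaussTermL1, gaussTermL1, ← Integrable.toL1_add, Integrable.toL1_eq_toL1_iff]
  refine (gaussTerm_congr_ae n (L1.integrable_coeFn _) (Lp.coeFn_add f g)).trans ?_
  exact Eventually.of_forall fun x => smul_add _ _ _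

theorem gaussTermL1_smul (n : ℕ) (a : ℂ) (f : ℝ →₁[leb01] ℂ) :
    gaussTermL1 n (a • f) = a • gaussTermL1 n f := by
  rw [gaussTermL1, gaussTermL1, ← Integrable.toL1_smul', Integrable.toL1_eq_toL1_iff]
  refine (gaussTerm_congr_ae n (L1.integrable_coeFn _) (Lp.coeFn_smul a f)).trans ?_
  exact Eventually.of_forall fun x => smul_comm _ a (f (branch n x))

theorem norm_gaussTermL1 (n : ℕ) (f : ℝ →₁[leb01] ℂ) :
    ‖gaussTermL1 n f‖ = ∫ x in branchIoc n, ‖f x‖ := by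
  rw [gaussTermL1, L1.norm_of_fun_eq_integral_norm, integral_norm_gaussTerm]

theorem hasSum_norm_gaussTermL1 (f : ℝ →₁[leb01] ℂ) :
    HasSum (fun n => ‖gaussTermL1 n f‖) ‖f‖ := by
  simp only [norm_gaussTermL1, L1.norm_eq_integral_norm f]
  exact hasSum_integral_branchIoc (L1.integrable_coeFn f).norm

theorem summable_gaussTermL1 (f : ℝ →₁[leb01] ℂ) : Summable fun n => gaussTermL1 n f :=
  (hasSum_norm_gaussTermL1 f).summable.of_norm

/-- The Gauss-Kuzmin-Wirsing operator on `L¹([0,1])`. -/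
def gaussL1 : (ℝ →₁[leb01] ℂ) →L[ℂ] (ℝ →₁[leb01] ℂ) :=
  LinearMap.mkContinuous
    { toFun := fun f => ∑' n, gaussTermL1 n f
      map_add' := fun f g => by
        simp only [gaussTermL1_add]
        exact (summable_gaussTermL1 f).tsum_add (summable_gaussTermL1 g)
      map_smul' := fun a f => by
        simp only [gaussTermL1_smul]
        exact (summable_gaussTermL1 f).tsum_const_smul a } 1
    fun f => (tsum_of_norm_bounded (hasSum_norm_gaussTermL1 f) fun _ => le_rfl).trans_eq
      (one_mul _).symm

theorem hasSum_gaussL1 (f : ℝ →₁[leb01] ℂ) : HasSum (fun n => gaussTermL1 n f) (gaussL1 f) :=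
  (summable_gaussTermL1 f).hasSum

theorem integral_gaussL1 (f : ℝ →₁[leb01] ℂ) : ∫ x, gaussL1 f x ∂leb01 = ∫ x, f x ∂leb01 := by
  have h1 := (hasSum_gaussL1 f).mapL (L1.integralCLM (α := ℝ) (E := ℂ) (μ := leb01))
  simp only [← L1.integral_eq, L1.integral_eq_integral] at h1
  refine h1.unique ((hasSum_integral_branchIoc (L1.integrable_coeFn f)).congr_fun fun n => ?_)
  rw [integral_congr_ae (coeFn_gaussTermL1 n f), integral_gaussTerm]

theorem weight_one_zero (c : ℕ → ℝ) (n : ℕ) (z : ℂ) : weight c 1 0 n z = 1 / (z + n) ^ 2 := by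
  rw [weight, zero_mul, Complex.exp_zero, mul_zero, add_zero, mul_one]
  norm_num

theorem gaussTerm_eq_weight (c : ℕ → ℝ) (n : ℕ) (f : ℝ → ℂ) (x : ℝ) :
    gaussTerm n f x = weight c 1 0 (n + 1) (x : ℂ) * f (1 / (x + ((n + 1 : ℕ) : ℝ))) := by
  rw [weight_one_zero, gaussTerm, abs_div, abs_neg, abs_one, abs_of_nonneg (by positivity),
    Complex.real_smul, branch]
  push_cast
  rfl

theorem ae_hasSum_gaussL1 (c : ℕ → ℝ) (f : ℝ → ℂ) (hf : Integrable f leb01) :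
    ∀ᵐ (x : ℝ) ∂leb01,
      HasSum (fun n : ℕ => weight c 1 0 (n + 1) (x : ℂ) * f (1 / (x + ((n + 1 : ℕ) : ℝ))))
        (gaussL1 (hf.toL1 f) x) := by
  have h1 : ∑' n, ‖gaussTermL1 n (hf.toL1 f)‖ₑ ≠ ⊤ :=
    tsum_enorm_ne_top_iff_summable_norm.2 (hasSum_norm_gaussTermL1 _).summable
  have h2 : ∀ᵐ (x : ℝ) ∂leb01, ∀ n, gaussTermL1 n (hf.toL1 f) x = gaussTerm n f x :=
    ae_all_iff.2 fun n => (coeFn_gaussTermL1 n _).trans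
      (gaussTerm_congr_ae n (L1.integrable_coeFn _) hf.coeFn_toL1)
  filter_upwards [Lp.hasSum_coeFn_tsum h1, h2] with x hx1 hx2
  simp only [hx2, gaussTerm_eq_weight c] at hx1
  exact hx1

/-- On `[0, 1)` the Gauss map inverts every branch, so `g x` factors out of the series. -/
theorem ae_gaussL1_mul_comp (f g : ℝ → ℂ) (hf : Integrable f leb01)
    (hfg : Integrable (fun x => f x * g (gaussMap x)) leb01) :
    ∀ᵐ (x : ℝ) ∂leb01,
      gaussL1 (hfg.toL1 fun x => f x * g (gaussMap x)) x = gaussL1 (hf.toL1 f) x * g x := by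
  -- At `ω = 0` the weight does not depend on the cost, so the zero cost serves.
  filter_upwards [ae_hasSum_gaussL1 0 _ hfg, ae_hasSum_gaussL1 0 f hf, ae_mem_Ico]
    with x h1 h2 hx
  refine h1.unique ((h2.mul_right (g x)).congr_fun fun n => ?_)
  have h := gaussMap_branch n hx
  rw [branch] at h
  rw [h, mul_assoc]

/-! ### Composition with the Gauss map on `L¹`. -/

theorem measurable_gaussMap : Measurable gaussMap := by
  unfold gaussMap
  fun_prop

theorem preimage_inter_branchIoc (s : Set ℝ) (n : ℕ) :
    gaussMap ⁻¹' s ∩ branchIoc n = branch n '' (s ∩ Set.Ico 0 1) := by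
  rw [← image_branch]
  ext y
  constructor
  · rintro ⟨hy, x, hx, rfl⟩
    rw [Set.mem_preimage, gaussMap_branch n hx] at hy
    exact ⟨x, ⟨hy, hx⟩, rfl⟩
  · rintro ⟨x, ⟨hs, hx⟩, rfl⟩
    exact ⟨by rwa [Set.mem_preimage, gaussMap_branch n hx], x, hx, rfl⟩

theorem volume_image_branch_le {s : Set ℝ} (hs : MeasurableSet s) (n : ℕ) :
    volume (branch n '' (s ∩ Set.Ico 0 1)) ≤
      ENNReal.ofReal (1 / ((n + 1 : ℕ) : ℝ) ^ 2) * leb01 s := by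
  have hm : MeasurableSet (s ∩ Set.Ico (0 : ℝ) 1) := hs.inter measurableSet_Ico
  have h := lintegral_image_eq_lintegral_abs_deriv_mul hm
    (fun x hx => (hasDerivAt_branch n hx.2.1).hasDerivWithinAt)
    ((branch_injOn n).mono Set.inter_subset_right) fun _ => 1
  simp only [lintegral_const, one_mul, mul_one, Measure.restrict_apply MeasurableSet.univ,
    Set.univ_inter] at h
  rw [h, leb01_eq_Ico, Measure.restrict_apply hs]
  calc ∫⁻ x in s ∩ Set.Ico 0 1, ENNReal.ofReal |-1 / (x + ((n + 1 : ℕ) : ℝ)) ^ 2|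
      ≤ ∫⁻ _ in s ∩ Set.Ico 0 1, ENNReal.ofReal (1 / ((n + 1 : ℕ) : ℝ) ^ 2) := by
        refine setLIntegral_mono measurable_const fun x hx => ENNReal.ofReal_le_ofReal ?_
        have hx0 : 0 ≤ x := hx.2.1
        rw [abs_div, abs_neg, abs_one, abs_of_nonneg (by positivity)]
        exact one_div_le_one_div_of_le (by positivity)
          (pow_le_pow_left₀ (by positivity) (by linarith) 2)
    _ = _ := by simp

theorem summable_one_div_succ_sq : Summable fun n : ℕ => 1 / ((n + 1 : ℕ) : ℝ) ^ 2 :=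
  (summable_nat_add_iff 1).2 (Real.summable_one_div_nat_pow.2 one_lt_two)

/-- The `n`-th branch contracts by at least `1 / (n + 1) ^ 2`, and these factors are summable. The
extra 1 only makes the constant visibly exceed 1. -/
theorem map_gaussMap_le :
    leb01.map gaussMap ≤
      ENNReal.ofReal (1 + ∑' n : ℕ, 1 / ((n + 1 : ℕ) : ℝ) ^ 2) • leb01 := by
  refine Measure.le_iff.2 fun s hs => ?_
  rw [Measure.map_apply measurable_gaussMap hs, leb01_eq_Ioc, ← iUnion_branchIoc,
    Measure.restrict_apply (measurable_gaussMap hs), Set.inter_iUnion]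
  calc volume (⋃ n, gaussMap ⁻¹' s ∩ branchIoc n)
      ≤ ∑' n, volume (gaussMap ⁻¹' s ∩ branchIoc n) := measure_iUnion_le _
    _ ≤ ∑' n : ℕ, ENNReal.ofReal (1 / ((n + 1 : ℕ) : ℝ) ^ 2) * leb01 s := by
        refine ENNReal.tsum_le_tsum fun n => ?_
        rw [preimage_inter_branchIoc]
        exact volume_image_branch_le hs n
    _ = ENNReal.ofReal (∑' n : ℕ, 1 / ((n + 1 : ℕ) : ℝ) ^ 2) * leb01 s := by
        rw [ENNReal.tsum_mul_right, ENNReal.ofReal_tsum_of_nonneg (fun n => by positivity)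
          summable_one_div_succ_sq]
    _ ≤ ENNReal.ofReal (1 + ∑' n : ℕ, 1 / ((n + 1 : ℕ) : ℝ) ^ 2) * leb01 s := by
        gcongr
        linarith
    _ = _ := by rw [iUnion_branchIoc, ← leb01_eq_Ioc]; rfl

theorem exists_norm_comp_gaussMap_le :
    ∃ C : ℝ, 1 < C ∧ ∀ f : ℝ → ℂ, Integrable f leb01 →
      Integrable (fun x => f (gaussMap x)) leb01 ∧
      ∫ x, ‖f (gaussMap x)‖ ∂leb01 ≤ C * ∫ x, ‖f x‖ ∂leb01 := by
  have hpos : 0 < ∑' n : ℕ, 1 / ((n + 1 : ℕ) : ℝ) ^ 2 :=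
    summable_one_div_succ_sq.tsum_pos (fun n => by positivity) 0 (by positivity)
  refine ⟨1 + ∑' n : ℕ, 1 / ((n + 1 : ℕ) : ℝ) ^ 2, by linarith, fun f hf => ?_⟩
  have hmap : Integrable f (leb01.map gaussMap) :=
    hf.of_measure_le_smul ENNReal.ofReal_ne_top map_gaussMap_le
  have hm : AEMeasurable gaussMap leb01 := measurable_gaussMap.aemeasurable
  refine ⟨hmap.comp_aemeasurable hm, ?_⟩
  rw [← integral_map (f := fun x => ‖f x‖) hm hmap.1.norm]
  refine (integral_mono_measure map_gaussMap_le (Eventually.of_forall fun _ => norm_nonneg _)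
    (hf.norm.smul_measure ENNReal.ofReal_ne_top)).trans_eq ?_
  rw [integral_smul_measure, ENNReal.toReal_ofReal (by linarith), smul_eq_mul]

/-! ### The Gauss density and the dominant eigenvalue at `(1, 0)` -/

theorem continuousOn_hval_ofReal (f : Hinf) :
    ContinuousOn (fun x : ℝ => hval f (x : ℂ)) (Set.Icc 0 1) :=
  (continuousOn_hval f).comp Complex.continuous_ofReal.continuousOn
    fun _ hx => ofReal_mem_disc hx.1 hx.2

theorem integrable_hval_ofReal (f : Hinf) : Integrable (fun x : ℝ => hval f (x : ℂ)) leb01 :=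
  (continuousOn_hval_ofReal f).integrableOn_Icc

theorem intervalIntegral_eq_integral_leb01 (g : ℝ → ℂ) :
    ∫ x in (0 : ℝ)..1, g x = ∫ x, g x ∂leb01 := by
  rw [leb01_eq_Ioc, intervalIntegral.integral_of_le zero_le_one]

/-- Integration over `[0, 1]`, as a bounded functional on `Hinf`. -/
def intFun : Hinf →L[ℂ] ℂ :=
  LinearMap.mkContinuous
    { toFun := fun f => ∫ x in (0 : ℝ)..1, hval f (x : ℂ)
      map_add' := fun f g => by
        simp only [hval_add, intervalIntegral_eq_integral_leb01]
        exact integral_add (integrable_hval_ofReal f) (integrable_hval_ofReal g)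
      map_smul' := fun a f => by
        simp only [hval_smul]
        exact intervalIntegral.integral_const_mul a _ } 1
    fun f => by
      refine (intervalIntegral.norm_integral_le_of_norm_le_const
        fun x _ => norm_hval_le f (x : ℂ)).trans_eq ?_
      rw [sub_zero, abs_one, mul_one, one_mul]

theorem intFun_apply (f : Hinf) : intFun f = ∫ x in (0 : ℝ)..1, hval f (x : ℂ) := rfl

theorem one_add_ne_zero_of_mem_disc {z : ℂ} (hz : z ∈ disc) : 1 + z ≠ 0 := by
  have := add_natCast_ne_zero hz le_rfl
  rwa [Nat.cast_one, add_comm] at this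

theorem ofReal_log_two_ne_zero : (Real.log 2 : ℂ) ≠ 0 :=
  Complex.ofReal_ne_zero.2 (Real.log_pos one_lt_two).ne'

theorem differentiableOn_xi : DifferentiableOn ℂ xi disc := fun z hz => by
  have h : (Real.log 2 : ℂ) * (1 + z) ≠ 0 :=
    mul_ne_zero ofReal_log_two_ne_zero (one_add_ne_zero_of_mem_disc hz)
  unfold xi
  exact DifferentiableAt.differentiableWithinAt (by fun_prop (disch := assumption))

theorem norm_xi_le {z : ℂ} (hz : z ∈ disc) : ‖xi z‖ ≤ 1 / (Real.log 2 * (2 / 3)) := by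
  have hlog : 0 < Real.log 2 := Real.log_pos one_lt_two
  have h := two_thirds_lt_re_add hz le_rfl
  rw [Nat.cast_one, add_comm] at h
  rw [xi, norm_div, norm_one, norm_mul, Complex.norm_real, Real.norm_of_nonneg hlog.le]
  exact one_div_le_one_div_of_le (by positivity)
    (mul_le_mul_of_nonneg_left (h.le.trans (Complex.re_le_norm _)) hlog.le)

/-- The Gauss density as an element of `Hinf`. -/
def xiH : Hinf := ofBounded xi differentiableOn_xi _ fun _ hz => norm_xi_le hz

theorem hval_xiH {z : ℂ} (hz : z ∈ disc) : hval xiH z = xi z := hval_ofBounded hz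

theorem intFun_xiH : intFun xiH = 1 := by
  have h1 : ∀ x ∈ Set.uIcc (0 : ℝ) 1,
      hval xiH (x : ℂ) = (((Real.log 2)⁻¹ * (1 + x)⁻¹ : ℝ) : ℂ) := fun x hx => by
    rw [Set.uIcc_of_le zero_le_one] at hx
    rw [hval_xiH (ofReal_mem_disc hx.1 hx.2), xi, one_div, mul_inv]
    push_cast
    rfl
  rw [intFun_apply, intervalIntegral.integral_congr h1, intervalIntegral.integral_ofReal,
    intervalIntegral.integral_const_mul,
    intervalIntegral.integral_comp_add_left (fun y : ℝ => y⁻¹) 1,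
    integral_inv_of_pos (by norm_num) (by norm_num)]
  norm_num

theorem tendsto_one_div_add_natCast (z : ℂ) :
    Tendsto (fun n : ℕ => 1 / (z + n)) atTop (𝓝 0) := by
  have h : Tendsto (fun n : ℕ => ‖(n : ℂ)‖ - ‖z‖) atTop atTop := by
    simp only [Complex.norm_natCast]
    exact tendsto_atTop_add_const_right _ _ tendsto_natCast_atTop_atTop
  have h2 : Tendsto (fun n : ℕ => ‖z + n‖) atTop atTop :=
    tendsto_atTop_mono (fun n => by
      have := norm_sub_le (z + n) z
      rw [add_sub_cancel_left] at this
      linarith) h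
  simp only [one_div]
  exact tendsto_inv₀_cobounded.comp (tendsto_norm_atTop_iff_cobounded.1 h2)

theorem eq_of_hasSum_of_tendsto_sum_range {f : ℕ → ℂ} {a b : ℂ} (hf : HasSum f b)
    (h : Tendsto (fun N => ∑ n ∈ Finset.range N, f n) atTop (𝓝 a)) : b = a :=
  tendsto_nhds_unique hf.tendsto_sum_nat h

/-! ### Invariance, the maximum principle and the spectral gap at `(1, 0)`. -/

section

variable {c : ℕ → ℝ} {L : Hinf →L[ℂ] Hinf}

theorem weight_mul_xi {z : ℂ} (hz : z ∈ disc) (n : ℕ) :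
    weight c 1 0 (n + 1) z * hval xiH (1 / (z + ((n + 1 : ℕ) : ℂ))) =
      (Real.log 2 : ℂ)⁻¹ * (1 / (z + 1 + (n : ℕ)) - 1 / (z + 1 + ((n + 1 : ℕ) : ℂ))) := by
  have hmem : 1 / (z + ((n + 1 : ℕ) : ℂ)) ∈ disc :=
    closedBall_subset_disc (mapsTo_branch (Nat.le_add_left 1 n) hz)
  have h1 := add_natCast_ne_zero hz (Nat.le_add_left 1 n)
  have h2 := add_natCast_ne_zero hz (Nat.le_add_left 1 (n + 1))
  have hl := ofReal_log_two_ne_zero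
  rw [weight_one_zero, hval_xiH hmem, xi]
  push_cast at h1 h2 ⊢
  have e1 : z + 1 + (n : ℂ) = z + (n + 1) := by ring
  have e2 : z + 1 + ((n : ℂ) + 1) = z + (n + 1 + 1) := by ring
  rw [e1, e2]
  have e3 : 1 + 1 / (z + ((n : ℂ) + 1)) = (z + (n + 1 + 1)) / (z + (n + 1)) := by
    field_simp
    ring
  rw [e3]
  field_simp
  ring

theorem map_xiH (hL : IsTransferOp c 1 1 0 L) : L xiH = xiH := by
  refine Hinf.ext_hval fun z hz => ?_
  refine eq_of_hasSum_of_tendsto_sum_range (hL xiH z hz) ?_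
  simp only [weight_mul_xi hz, ← Finset.mul_sum]
  have h1 : ∀ N : ℕ, ∑ n ∈ Finset.range N,
      (1 / (z + 1 + (n : ℂ)) - 1 / (z + 1 + ((n + 1 : ℕ) : ℂ))) =
        1 / (z + 1) - 1 / (z + 1 + (N : ℂ)) := fun N => by
    rw [Finset.sum_range_sub' (fun n : ℕ => 1 / (z + 1 + (n : ℂ)))]
    simp
  simp only [h1]
  have h2 : hval xiH z = (Real.log 2 : ℂ)⁻¹ * (1 / (z + 1) - 0) := by
    rw [hval_xiH hz, xi, sub_zero, one_div, one_div, mul_inv, add_comm 1 z]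
  rw [h2]
  exact ((tendsto_const_nhds.sub (tendsto_one_div_add_natCast (z + 1)))).const_mul _

/-- On `[0, 1]` the function `L f` agrees almost everywhere with `gaussL1` of `f`, which preserves
integrals. -/
theorem intFun_map (hL : IsTransferOp c 1 1 0 L) (f : Hinf) : intFun (L f) = intFun f := by
  have hf := integrable_hval_ofReal f
  have h : (fun x : ℝ => hval (L f) (x : ℂ)) =ᵐ[leb01]
      gaussL1 (hf.toL1 fun x : ℝ => hval f (x : ℂ)) := by
    filter_upwards [ae_hasSum_gaussL1 c _ hf, ae_mem_Ico] with x h1 hx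
    refine (hL f x (ofReal_mem_disc hx.1 hx.2.le)).unique (h1.congr_fun fun n => ?_)
    push_cast
    rfl
  rw [intFun_apply, intFun_apply, intervalIntegral_eq_integral_leb01,
    intervalIntegral_eq_integral_leb01, integral_congr_ae h, integral_gaussL1]
  exact integral_congr_ae hf.coeFn_toL1

/-- Equality case of the triangle inequality for a convex combination. -/
theorem eq_of_hasSum_convex {p : ℕ → ℝ} {g : ℕ → ℂ} {t : ℂ} (hp : ∀ n, 0 < p n)
    (hp1 : HasSum p 1) (hg : ∀ n, ‖g n‖ ≤ ‖t‖) (h : HasSum (fun n => (p n : ℂ) * g n) t) (n : ℕ) :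
    g n = t := by
  have h1 : HasSum (fun n => p n * (inner ℝ t (g n))) (‖t‖ ^ 2) := by
    have := h.mapL (innerSL ℝ t)
    simpa [real_inner_self_eq_norm_sq, ← Complex.real_smul, inner_smul_right] using this
  -- Nonnegative terms with sum zero all vanish.
  have h2 : HasSum (fun n => p n * (‖t‖ ^ 2 - inner ℝ t (g n))) 0 := by
    have := (hp1.mul_right (‖t‖ ^ 2)).sub h1
    rw [one_mul, sub_self] at this
    simpa only [mul_sub] using this
  have hle : ∀ n, inner ℝ t (g n) ≤ ‖t‖ ^ 2 := fun n => by
    have h3 := real_inner_le_norm t (g n)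
    have h4 := mul_le_mul_of_nonneg_left (hg n) (norm_nonneg t)
    nlinarith
  have h3 := (hasSum_zero_iff_of_nonneg fun n =>
    mul_nonneg (hp n).le (sub_nonneg.2 (hle n))).1 h2
  have h4 : ‖t‖ ^ 2 - inner ℝ t (g n) = 0 := by
    have := congrFun h3 n
    exact (mul_eq_zero.1 this).resolve_left (hp n).ne'
  have h5 := norm_sub_sq_real t (g n)
  have h6 : ‖g n‖ ^ 2 ≤ ‖t‖ ^ 2 := pow_le_pow_left₀ (norm_nonneg _) (hg n) 2
  have h7 : ‖t - g n‖ ^ 2 = 0 := le_antisymm (by linarith) (sq_nonneg _)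
  exact (sub_eq_zero.1 (norm_eq_zero.1 (pow_eq_zero_iff two_ne_zero |>.1 h7))).symm

/-- The transition weights of the normalized Gauss-Kuzmin-Wirsing operator. -/
def transWeight (x : ℝ) (n : ℕ) : ℝ := (1 + x) / ((x + n + 1) * (x + n + 2))

theorem transWeight_pos {x : ℝ} (hx : 0 ≤ x) (n : ℕ) : 0 < transWeight x n := by
  unfold transWeight
  positivity

theorem weight_mul_eq_transWeight_mul {x : ℝ} (hx : 0 ≤ x) (n : ℕ) (v : ℂ) :
    (1 + (x : ℂ)) * (weight c 1 0 (n + 1) (x : ℂ) * v) =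
      (transWeight x n : ℂ) * ((1 + 1 / ((x : ℂ) + ((n + 1 : ℕ) : ℂ))) * v) := by
  have h1 : (x : ℂ) + (n + 1) ≠ 0 := by
    have : x + (n + 1) ≠ 0 := by positivity
    exact_mod_cast this
  have h2 : (x : ℂ) + (n + 2) ≠ 0 := by
    have : x + (n + 2) ≠ 0 := by positivity
    exact_mod_cast this
  rw [weight_one_zero, transWeight]
  push_cast
  have e3 : 1 + 1 / ((x : ℂ) + ((n : ℂ) + 1)) = (x + (n + 2)) / (x + (n + 1)) := by
    field_simp
    ring
  rw [e3, add_assoc (x : ℂ), add_assoc (x : ℂ)]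
  field_simp

/-- This is `L ξ = ξ` after multiplication by `1 + x`. -/
theorem hasSum_transWeight (hL : IsTransferOp c 1 1 0 L) {x : ℝ} (hx : x ∈ Set.Icc (0 : ℝ) 1) :
    HasSum (transWeight x) 1 := by
  have hz := ofReal_mem_disc hx.1 hx.2
  have h1 := (hL xiH x hz).mul_left (1 + (x : ℂ))
  have hl := ofReal_log_two_ne_zero
  simp only [weight_mul_eq_transWeight_mul hx.1, map_xiH hL] at h1
  have h2 := h1.mul_left (Real.log 2 : ℂ)
  have hone : ∀ z ∈ disc, (Real.log 2 : ℂ) * ((1 + z) * hval xiH z) = 1 := fun z hz => by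
    have := one_add_ne_zero_of_mem_disc hz
    rw [hval_xiH hz, xi]
    field_simp
  rw [hone _ hz] at h2
  have h3 : HasSum (fun n => (transWeight x n : ℂ)) ((1 : ℝ) : ℂ) := by
    rw [Complex.ofReal_one]
    refine h2.congr_fun fun n => ?_
    have hmem : 1 / ((x : ℂ) + ((n + 1 : ℕ) : ℂ)) ∈ disc :=
      closedBall_subset_disc (mapsTo_branch (Nat.le_add_left 1 n) hz)
    rw [mul_left_comm, hone _ hmem, mul_one]
  exact Complex.hasSum_ofReal.1 h3

/-- Since `k * g` is an average of `g` over the branch points and `1 ≤ ‖k‖`, at a maximum of `‖g‖`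
every averaged value equals `k * g`. The branch points tend to 0, so 0 is a maximum too; repeating
there gives `g = g 0` at all `1 / (n + 1)`. The identity theorem makes `(1 + z) f` constant, so `f`
is a multiple of `ξ`, and its integral is zero. -/
theorem eq_zero_of_map_eq_smul (hL : IsTransferOp c 1 1 0 L) {f : Hinf} {k : ℂ} (hk : 1 ≤ ‖k‖)
    (hf : L f = k • f) (hint : intFun f = 0) : f = 0 := by
  set F : ℂ → ℂ := fun z => (1 + z) * hval f z with hF
  have hFan : AnalyticOnNhd ℂ F disc := fun z hz =>
    (analyticAt_const.add analyticAt_id).mul (analyticAt_hval f hz)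
  have hFcont : ∀ z ∈ disc, ContinuousAt F z := fun z hz => (hFan z hz).continuousAt
  set g : ℝ → ℂ := fun x => F x with hg
  have hgc : ContinuousOn g (Set.Icc 0 1) := fun x hx =>
    (ContinuousAt.comp (f := fun x : ℝ => (x : ℂ)) (hFcont x (ofReal_mem_disc hx.1 hx.2))
      Complex.continuous_ofReal.continuousAt).continuousWithinAt
  obtain ⟨x₀, hx₀, hmax⟩ := isCompact_Icc.exists_isMaxOn ⟨0, by simp⟩ hgc.norm
  have hbr : ∀ x ∈ Set.Icc (0 : ℝ) 1, ∀ n, branch n x ∈ Set.Icc (0 : ℝ) 1 := fun x hx n => by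
    have hx0 := hx.1
    have hn : (0 : ℝ) ≤ n := n.cast_nonneg
    unfold branch
    push_cast
    refine ⟨by positivity, ?_⟩
    rw [div_le_one (by positivity)]
    linarith
  have hsum : ∀ x ∈ Set.Icc (0 : ℝ) 1,
      HasSum (fun n => (transWeight x n : ℂ) * g (branch n x)) (k * g x) := fun x hx => by
    have h1 := (hL f x (ofReal_mem_disc hx.1 hx.2)).mul_left (1 + (x : ℂ))
    simp only [weight_mul_eq_transWeight_mul hx.1, hf, hval_smul] at h1
    rw [mul_left_comm] at h1
    refine h1.congr_fun fun n => ?_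
    simp only [hg, hF, branch]
    push_cast
    rfl
  have key : ∀ x ∈ Set.Icc (0 : ℝ) 1, ‖g x‖ = ‖g x₀‖ → ∀ n, g (branch n x) = k * g x :=
    fun x hx hxmax n => by
      refine eq_of_hasSum_convex (g := fun n => g (branch n x)) (transWeight_pos hx.1)
        (hasSum_transWeight hL hx) (fun m => ?_) (hsum x hx) n
      rw [norm_mul k, hxmax]
      exact (hmax (hbr x hx m)).trans (le_mul_of_one_le_left (norm_nonneg _) hk)
  have hlim : ∀ x : ℝ, Tendsto (fun n => g (branch n x)) atTop (𝓝 (F 0)) := fun x => by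
    have h1 : Tendsto (fun n : ℕ => (branch n x : ℂ)) atTop (𝓝 0) := by
      have := (tendsto_one_div_add_natCast (x : ℂ)).comp (tendsto_add_atTop_nat 1)
      refine this.congr fun n => ?_
      simp only [Function.comp_apply, branch]
      push_cast
      rfl
    have h0 : (0 : ℂ) ∈ disc := by simpa using ofReal_mem_disc le_rfl zero_le_one
    exact (hFcont 0 h0).tendsto.comp h1
  have hF0 : F 0 = g 0 := by simp [hg]
  have hz : (0 : ℝ) ∈ Set.Icc (0 : ℝ) 1 := by simp
  have e1 : g 0 = k * g x₀ := by
    rw [← hF0]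
    refine tendsto_nhds_unique (hlim x₀) ?_
    simp only [key x₀ hx₀ rfl]
    exact tendsto_const_nhds
  have e2 : ‖g 0‖ = ‖g x₀‖ := by
    refine le_antisymm (hmax hz) ?_
    rw [e1, norm_mul k]
    exact le_mul_of_one_le_left (norm_nonneg _) hk
  have e3 : g 0 = k * g 0 := by
    nth_rewrite 1 [← hF0]
    refine tendsto_nhds_unique (hlim 0) ?_
    simp only [key 0 hz e2]
    exact tendsto_const_nhds
  have h0 : (0 : ℂ) ∈ disc := by simpa using ofReal_mem_disc le_rfl zero_le_one
  have hconst : Set.EqOn F (fun _ => F 0) disc := by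
    refine hFan.eqOn_of_preconnected_of_frequently_eq (fun _ _ => analyticAt_const)
      (convex_ball _ _).isPreconnected h0 ?_
    have ht : Tendsto (fun n : ℕ => (branch n 0 : ℂ)) atTop (𝓝[≠] 0) := by
      refine tendsto_nhdsWithin_iff.2 ⟨?_, Eventually.of_forall fun n => ?_⟩
      · have := (tendsto_one_div_add_natCast ((0 : ℝ) : ℂ)).comp (tendsto_add_atTop_nat 1)
        refine this.congr fun n => ?_
        simp only [Function.comp_apply, branch]
        push_cast
        rfl
      · have : branch n 0 ≠ 0 := by
          unfold branch
          positivity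
        exact Complex.ofReal_ne_zero.2 this
    refine ht.frequently (Frequently.of_forall fun n => ?_)
    change g (branch n 0) = F 0
    rw [key 0 hz e2 n, ← e3, hF0]
  have hfx : f = (F 0 * (Real.log 2 : ℂ)) • xiH := by
    refine Hinf.ext_hval fun z hz => ?_
    have h1 := one_add_ne_zero_of_mem_disc hz
    have h2 := ofReal_log_two_ne_zero
    have h3 : (1 + z) * hval f z = F 0 := hconst hz
    rw [hval_smul, hval_xiH hz, xi, ← h3]
    field_simp
  rw [hfx, map_smul, intFun_xiH, smul_eq_mul, mul_one] at hint
  rw [hfx, hint, zero_smul]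

/-- Nonzero spectral values of a compact operator are eigenvalues, and the spectral radius is
attained on the spectrum. -/
theorem spectralRadius_lt_one_of_isCompactOperator {E : Type*} [NormedAddCommGroup E]
    [NormedSpace ℂ E] [CompleteSpace E] [Nontrivial E] {A : E →L[ℂ] E} (hA : IsCompactOperator A)
    (h : ∀ (k : ℂ) (f : E), 1 ≤ ‖k‖ → A f = k • f → f = 0) : spectralRadius ℂ A < 1 := by
  refine spectrum.spectralRadius_lt_of_forall_lt A (r := 1) fun k hk => ?_
  by_contra hlt
  have hk1 : 1 ≤ ‖k‖ := NNReal.coe_le_coe.2 (not_lt.1 hlt)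
  have hk0 : k ≠ 0 := norm_pos_iff.1 (one_pos.trans_le hk1)
  obtain ⟨f, hf⟩ := ((hA.hasEigenvalue_iff_mem_spectrum hk0).2 hk).exists_hasEigenvector
  exact hf.2 (h k f hk1 hf.apply_eq_smul)

theorem isCompactOperator_sub_smulRight {E : Type*} [NormedAddCommGroup E]
    [NormedSpace ℂ E] {A : E →L[ℂ] E} (hA : IsCompactOperator A) (l : E →L[ℂ] ℂ) (e : E) :
    IsCompactOperator (A - l.smulRight e) :=
  (compactOperator (RingHom.id ℂ) E E).sub_mem (x := A) hA
    (isCompactOperator_smulRight l e)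

theorem nontrivial_Hinf : Nontrivial Hinf :=
  ⟨xiH, 0, fun h => by
    have := intFun_xiH
    rw [h, map_zero] at this
    exact zero_ne_one this⟩

theorem spectralRadius_sub_lt_one (hL : IsTransferOp c 1 1 0 L) (hLc : IsCompactOperator L) :
    spectralRadius ℂ (L - intFun.smulRight xiH) < 1 := by
  have := nontrivial_Hinf
  refine spectralRadius_lt_one_of_isCompactOperator
    (isCompactOperator_sub_smulRight hLc intFun xiH) fun k f hk hf => ?_
  have hf' : L f - intFun f • xiH = k • f := hf
  have hk0 : k ≠ 0 := norm_pos_iff.1 (one_pos.trans_le hk)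
  -- Integrating the eigenvalue equation leaves `0 = k * intFun f`.
  have h0 : intFun f = 0 := by
    have h := congrArg intFun hf'
    rw [map_sub, intFun_map hL, map_smul, map_smul, intFun_xiH, smul_eq_mul, mul_one, sub_self,
      smul_eq_mul, eq_comm] at h
    exact (mul_eq_zero.1 h).resolve_left hk0
  rw [h0, zero_smul, sub_zero] at hf'
  exact eq_zero_of_map_eq_smul hL hk hf' h0

end

end

end GaussEuclid

theorem mainTheorem2 (c : ℕ → ℝ) (hc_nonneg : ∀ n, 1 ≤ n → 0 ≤ c n)
    (hc_bdd : ∃ M : ℝ, ∀ n, 1 ≤ n → c n ≤ M) :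
    -- (i) on an open set `U` of pairs `(s, ω)` that contains `(s, 0)` whenever `Re s > 1/2`
    (∃ U : Set (ℂ × ℂ), IsOpen U ∧ (∀ p ∈ U, 1 / 2 < p.1.re) ∧
      (∀ s : ℂ, 1 / 2 < s.re → (s, (0 : ℂ)) ∈ U) ∧
      (∀ p ∈ U, IsTransferOp c 1 p.1 p.2 (opL c p) ∧ IsTransferOp c 2 p.1 p.2 (opF c p) ∧
        IsCompactOperator (opL c p) ∧ IsCompactOperator (opF c p)) ∧
      AnalyticOnNhd ℂ (opL c) U ∧ AnalyticOnNhd ℂ (opF c) U ∧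
      -- (iii) the spectral splitting near `(1, 0)`
      ∃ V : Set (ℂ × ℂ), IsOpen V ∧ ((1 : ℂ), (0 : ℂ)) ∈ V ∧ V ⊆ U ∧
        ∃ (lam : ℂ × ℂ → ℂ) (P N : ℂ × ℂ → (Hinf →L[ℂ] Hinf)),
          AnalyticOnNhd ℂ lam V ∧ AnalyticOnNhd ℂ P V ∧ AnalyticOnNhd ℂ N V ∧
          (∀ p ∈ V,
            opL c p = lam p • P p + N p ∧
            (P p).comp (N p) = 0 ∧ (N p).comp (P p) = 0 ∧
            (P p).comp (P p) = P p ∧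
            Module.finrank ℂ (LinearMap.range (P p : Hinf →ₗ[ℂ] Hinf)) = 1 ∧
            LinearMap.range (P p : Hinf →ₗ[ℂ] Hinf) =
              Module.End.eigenspace (opL c p : Hinf →ₗ[ℂ] Hinf) (lam p) ∧
            spectralRadius ℂ (N p) < 1 ∧
            spectralRadius ℂ (N p) < ‖lam p‖ₑ) ∧
          lam (1, 0) = 1 ∧
          ∀ (f : Hinf), ∀ z ∈ disc,
            hval (P (1, 0) f) z = (∫ x in (0 : ℝ)..1, hval f (x : ℂ)) * xi z) ∧
    -- (ii) the action of `𝓛_{1,0}` on `L¹([0,1])`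
    (∃ A : (ℝ →₁[leb01] ℂ) →L[ℂ] (ℝ →₁[leb01] ℂ),
      (∀ (f : ℝ → ℂ) (hf : Integrable f leb01), ∀ᵐ (x : ℝ) ∂leb01,
        HasSum (fun n : ℕ => weight c 1 0 (n + 1) (x : ℂ) * f (1 / (x + ((n + 1 : ℕ) : ℝ))))
          (A (hf.toL1 f) x)) ∧
      (∀ f : ℝ →₁[leb01] ℂ, ∫ x, A f x ∂leb01 = ∫ x, f x ∂leb01) ∧
      (∀ (f g : ℝ → ℂ) (hf : Integrable f leb01)
        (hfg : Integrable (fun x => f x * g (gaussMap x)) leb01),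
        ∀ᵐ (x : ℝ) ∂leb01,
          A (hfg.toL1 fun x => f x * g (gaussMap x)) x = A (hf.toL1 f) x * g x)) ∧
    (∃ C : ℝ, 1 < C ∧ ∀ f : ℝ → ℂ, Integrable f leb01 →
      Integrable (fun x => f (gaussMap x)) leb01 ∧
      ∫ x, ‖f (gaussMap x)‖ ∂leb01 ≤ C * ∫ x, ‖f x‖ ∂leb01) := by
  obtain ⟨hL, hLan⟩ := transferOp_properties c hc_nonneg hc_bdd (m := 1) le_rfl
  obtain ⟨hF, hFan⟩ := transferOp_properties c hc_nonneg hc_bdd (m := 2) one_le_two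
  refine ⟨⟨domainU c, isOpen_domainU c, fun p hp => hp.1, fun s hs => mem_domainU_zero c hs,
    fun p hp => ⟨(hL p hp).1, (hF p hp).1, (hL p hp).2, (hF p hp).2⟩, hLan, hFan, ?_⟩,
    ⟨gaussL1, ae_hasSum_gaussL1 c, integral_gaussL1, ae_gaussL1_mul_comp⟩,
    exists_norm_comp_gaussMap_le⟩
  have h10 : ((1 : ℂ), (0 : ℂ)) ∈ domainU c := mem_domainU_zero c (by norm_num)
  obtain ⟨hL0, hLc⟩ := hL _ h10
  obtain ⟨lam, P, N, hlam, hP, hN, hlam0, hP0, hev⟩ :=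
    exists_analytic_splitting (T := opL c) (hLan _ h10) intFun_xiH (map_xiH hL0) (intFun_map hL0)
      (spectralRadius_sub_lt_one hL0 hLc)
  -- Analyticity at a point persists nearby, so all requirements hold together on one open `V`.
  have hall := ((hlam.eventually_analyticAt.and hP.eventually_analyticAt).and
    hN.eventually_analyticAt).and (hev.and ((isOpen_domainU c).mem_nhds h10))
  obtain ⟨V, hV, hVo, hVm⟩ := eventually_nhds_iff.1 hall
  refine ⟨V, hVo, hVm, fun p hp => (hV p hp).2.2, lam, P, N, fun p hp => (hV p hp).1.1.1,
    fun p hp => (hV p hp).1.1.2, fun p hp => (hV p hp).1.2, fun p hp => ?_, hlam0,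
    fun f z hz => ?_⟩
  · obtain ⟨⟨h1, h2, h3, h4, h5, h6⟩, h7, h8⟩ := (hV p hp).2.1
    exact ⟨h1, h2, h3, h4, h5, h6, h7, h8⟩
  · rw [hP0, ContinuousLinearMap.smulRight_apply, hval_smul, hval_xiH hz, intFun_apply]
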